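/- Let $H^1=H^1(\mathbb R)$ be the real-valued Sobolev space with norm $\|f\|_{H^1}=(\|f\|_{L^2}^2+\|f_x\|_{L^2}^2)^{1/2}$, and let $Hf(x)=\frac1\pi\,\mathrm{P.V.}\!\int_{-\infty}^{\infty}\frac{f(y)}{x-y}\,dy$ be the Hilbert transform. Consider, on $\mathbb R$, the nonlocal system $$u_t=2uv,\qquad v_t=H(u^2),\qquad u(\cdot,0)=u_0,\quad v(\cdot,0)=v_0,$$ where solutions on a time interval $I$ are understood as pairs $(u,v)$ with $u,v\in C^1(I;H^1)$. Let $u_0,v_0\in H^1$, and suppose that $u_0$ is supported in a closed interval of length $\delta\ge 0$ and that $v_0\le -3$ on this interval. If $$\delta^{1/2}\Bigl(\|v_{0x}\|_{L^2}+\tfrac13\,\delta^{1/2}\|u_{0x}\|_{L^2}^2\Bigr)<\tfrac14,$$ then the system has a solution $(u,v)$ on $[0,\infty)$; every solution with the same initial data on an interval $[0,T)$, $T>0$, coincides with it on $[0,T)$; and $\|u(t)\|_{H^1}$ and $\|v(t)\|_{H^1}$ remain bounded for all $t\ge0$. Moreover, there is a constant $C$, depending only on $u_0$, $v_0$ and $\delta$,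 such that for all $t\ge 0$ $$\|u(t)\|_{L^\infty}\le Ce^{-3t},\qquad \|u(t)\|_{H^1}\le Ce^{-3t},\qquad \|v(t)\|_{H^1}\le C.$$ -/

import Mathlib

open MeasureTheory Set Filter Topology
open scoped ENNReal ContDiff

namespace NonlocalSystem

/-- `g` is the weak derivative of `f` on the real line:
`∫ f φ' = - ∫ g φ` for every smooth compactly supported `φ`. -/
def IsWeakDeriv (f g : ℝ → ℝ) : Prop :=
  ∀ φ : ℝ → ℝ, ContDiff ℝ ∞ φ → HasCompactSupport φ →
    ∫ x, f x * deriv φ x = -∫ x, g x * φ x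

/-- Real-valued `L²(ℝ)`. -/
abbrev L2 : Type := Lp ℝ 2 (volume : Measure ℝ)

theorem integrable_mul_test (f : L2) {φ : ℝ → ℝ} (hc : Continuous φ)
    (hφ : HasCompactSupport φ) : Integrable (fun x => f x * φ x) :=
  (Lp.memLp f).integrable_mul (q := 2) (hc.memLp_of_hasCompactSupport hφ)

/-- The Sobolev space `H¹(ℝ)`, as the space of pairs `(f, f_x)` of `L²` functions in which `f_x` is
the weak derivative of `f` (so that `f_x` is determined by `f`). The `2`-norm on the product makes
the norm of `f` equal to `(‖f‖_{L²}² + ‖f_x‖_{L²}²)^{1/2}`. -/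
def H1Submodule : Submodule ℝ (WithLp 2 (L2 × L2)) where
  carrier := {p | IsWeakDeriv p.fst p.snd}
  zero_mem' := by
    intro φ hφ hs
    have key : ∀ ψ : ℝ → ℝ, ∫ x, (0 : L2) x * ψ x = 0 := by
      intro ψ
      refine integral_eq_zero_of_ae ?_
      filter_upwards [Lp.coeFn_zero ℝ 2 (volume : Measure ℝ)] with x hx
      rw [hx, Pi.zero_apply, zero_mul]
    change ∫ x, (0 : L2) x * deriv φ x = -∫ x, (0 : L2) x * φ x
    rw [key, key, neg_zero]
  add_mem' := by
    intro p q hp hq φ hφ hs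
    have key : ∀ (f g : L2) {ψ : ℝ → ℝ}, Continuous ψ → HasCompactSupport ψ →
        ∫ x, (f + g : L2) x * ψ x = (∫ x, f x * ψ x) + ∫ x, g x * ψ x := by
      intro f g ψ hc hψ
      rw [← integral_add (integrable_mul_test f hc hψ) (integrable_mul_test g hc hψ)]
      refine integral_congr_ae ?_
      filter_upwards [Lp.coeFn_add f g] with x hx
      rw [hx, Pi.add_apply, add_mul]
    have h1 := key p.fst q.fst (hφ.continuous_deriv (by simp)) hs.deriv
    have h2 := key p.snd q.snd hφ.continuous hs
    change ∫ x, (p.fst + q.fst : L2) x * deriv φ x = -∫ x, (p.snd + q.snd : L2) x * φ x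
    rw [h1, h2, hp φ hφ hs, hq φ hφ hs, neg_add]
  smul_mem' := by
    intro c p hp φ hφ hs
    have key : ∀ (f : L2) (ψ : ℝ → ℝ),
        ∫ x, (c • f : L2) x * ψ x = c * ∫ x, f x * ψ x := by
      intro f ψ
      rw [← integral_const_mul]
      refine integral_congr_ae ?_
      filter_upwards [Lp.coeFn_smul c f] with x hx
      rw [hx, Pi.smul_apply, smul_eq_mul, mul_assoc]
    change ∫ x, (c • p.fst : L2) x * deriv φ x = -∫ x, (c • p.snd : L2) x * φ x
    rw [key, key, hp φ hφ hs, mul_neg]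

/-- The Sobolev space `H¹(ℝ)` with its norm. -/
abbrev H1 : Type := ↥H1Submodule

/-- The `L²` function underlying an element of `H¹`. -/
def H1.fn (f : H1) : L2 := (f : WithLp 2 (L2 × L2)).fst

/-- The weak derivative `f_x`, as an element of `L²`. -/
def H1.dx (f : H1) : L2 := (f : WithLp 2 (L2 × L2)).snd

/-- The Hilbert transform `(H f)(x) = (1/π) P.V. ∫ f(y) / (x - y) dy` exists at `x` and equals `c`. -/
def HasHilbertTransformAt (f : ℝ → ℝ) (x c : ℝ) : Prop :=
  Tendsto (fun ε : ℝ => (1 / Real.pi) * ∫ y in {y : ℝ | ε < |x - y|}, f y / (x - y))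
    (𝓝[>] 0) (𝓝 c)

/-- `(u, v)` is a solution in `C¹(I; H¹)` of `u_t = 2 u v`, `v_t = H(u²)` with initial values
`u₀, v₀`, on a time interval `I` with left end point `0 ∈ I`. At each time the two equations are
identities of functions of `x`, up to null sets. -/
structure IsSolutionOn (I : Set ℝ) (u₀ v₀ : H1) (u v : ℝ → H1) : Prop where
  initial_u : u 0 = u₀
  initial_v : v 0 = v₀
  contDiffOn_u : ContDiffOn ℝ 1 u I
  contDiffOn_v : ContDiffOn ℝ 1 v I
  eqn_u : ∀ t ∈ I, ∀ᵐ x, (derivWithin u I t).fn x = 2 * (u t).fn x * (v t).fn x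
  eqn_v : ∀ t ∈ I, ∀ᵐ x,
    HasHilbertTransformAt (fun y => (u t).fn y ^ 2) x ((derivWithin v I t).fn x)

end NonlocalSystem

/-! On `H¹`, an algebra of bounded functions on which the Hilbert transform is a contraction, the
system is an ordinary differential equation with a locally Lipschitz vector field, so only an a
priori bound is needed. At each fixed `x` the equation `u_t = 2uv` is linear in `u`; hence the zeros
of `u₀` persist and `u` stays supported in an interval of length `δ`, where `|u| ≤ √δ ‖u_x‖`. With
`D = ‖u_x‖²`, the equation for `v` therefore gives `‖v_x‖ ≤ ‖v₀ₓ‖ + 2√δ ∫D` and, on the interval,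
`v ≤ -3 + 4δ ∫D`, and the equation for `u` gives
`D' ≤ 4 D (-3 + √δ ‖v₀ₓ‖ + 6δ ∫D)`.
As long as the bracket is at most `-2`, `D` decays like `e^{-8t}` and `8 ∫D ≤ D(0)`; by the
smallness assumption the bracket is then strictly below `-2`, so this persists for all time.

For `f ∈ H¹`, splitting off `f x` near the singularity turns the principal value into an absolutely
convergent integral, which is the limit of convolutions with the conjugate Poisson kernels. The
Fourier transforms of these kernels are bounded by `1`, whence the contraction property. -/

namespace NonlocalSystem

theorem L2.locallyIntegrable (f : L2) : LocallyIntegrable f volume :=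
  (Lp.memLp f).locallyIntegrable (by norm_num)

theorem L2.inner_eq (f g : L2) : inner ℝ f g = ∫ x, f x * g x := by
  simp only [L2.inner_def, RCLike.inner_apply, conj_trivial, mul_comm]

theorem L2.norm_sq_eq (f : L2) : ‖f‖ ^ 2 = ∫ x, f x ^ 2 := by
  simp only [← real_inner_self_eq_norm_sq (F := L2), L2.inner_eq, sq]

theorem L2.integrable_sq (f : L2) : Integrable fun x => f x ^ 2 :=
  (Lp.memLp f).integrable_sq

theorem L2.abs_intervalIntegral_le (g : L2) {a b : ℝ} (hab : a ≤ b) :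
    |∫ x in a..b, g x| ≤ √(b - a) * ‖g‖ := by
  have inner_indicator := L2.inner_indicatorConstLp_one (𝕜 := ℝ)
    (measurableSet_Ioc (a := a) (b := b)) measure_Ioc_lt_top.ne g
  rw [intervalIntegral.integral_of_le hab, ← inner_indicator]
  refine (abs_real_inner_le_norm _ _).trans_eq ?_
  rw [norm_indicatorConstLp (by norm_num) (by norm_num)]
  simp [Real.sqrt_eq_rpow, measureReal_def, hab]

theorem integrable_mul_testFunction {h φ : ℝ → ℝ} (hh : LocallyIntegrable h volume)
    (hφ : Continuous φ) (hs : HasCompactSupport φ) : Integrable fun x => h x * φ x := by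
  simpa only [smul_eq_mul, mul_comm] using
    hh.integrable_smul_left_of_hasCompactSupport hφ hs

theorem exists_subset_Ioo {K : Set ℝ} (hK : IsCompact K) : ∃ R : ℝ, K ⊆ Ioo (-R) R := by
  obtain ⟨R, -, hR⟩ := hK.isBounded.subset_ball_lt 0 0
  exact ⟨R, by simpa only [Real.ball_eq_Ioo, zero_sub, zero_add] using hR⟩

/-- `F` is a primitive of the locally integrable function `g`; equivalently, `F` is locally
absolutely continuous with derivative `g` almost everywhere. -/
structure IsPrimitive (F g : ℝ → ℝ) : Prop where
  locallyIntegrable : LocallyIntegrable g volume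
  sub_eq_integral : ∀ a b, F b - F a = ∫ x in a..b, g x

namespace IsPrimitive

variable {F f G g : ℝ → ℝ}

theorem of_locallyIntegrable (hg : LocallyIntegrable g volume) (a : ℝ) :
    IsPrimitive (fun x => ∫ t in a..x, g t) g where
  locallyIntegrable := hg
  sub_eq_integral b c :=
    have integrable (c : ℝ) : IntervalIntegrable g volume a c :=
      (hg.integrableOn_isCompact isCompact_uIcc).intervalIntegrable
    intervalIntegral.integral_interval_sub_left (integrable c) (integrable b)

theorem const_add (h : IsPrimitive F f) (c : ℝ) : IsPrimitive (fun x => c + F x) f where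
  locallyIntegrable := h.locallyIntegrable
  sub_eq_integral a b := by rw [add_sub_add_left_eq_sub, h.sub_eq_integral]

theorem of_contDiff (hF : ContDiff ℝ 1 F) : IsPrimitive F (deriv F) where
  locallyIntegrable := (hF.continuous_deriv le_rfl).locallyIntegrable
  sub_eq_integral _ _ := (intervalIntegral.integral_deriv_eq_sub
    (fun _ _ => hF.differentiable one_ne_zero _)
    ((hF.continuous_deriv le_rfl).intervalIntegrable _ _)).symm

theorem intervalIntegrable (h : IsPrimitive F f) (a b : ℝ) : IntervalIntegrable f volume a b :=
  (h.locallyIntegrable.integrableOn_isCompact isCompact_uIcc).intervalIntegrable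

theorem eq_add_integral (h : IsPrimitive F f) (a : ℝ) : F = fun x => F a + ∫ t in a..x, f t := by
  funext x
  rw [← h.sub_eq_integral, add_sub_cancel]

theorem continuous (h : IsPrimitive F f) : Continuous F := by
  rw [h.eq_add_integral 0]
  exact continuous_const.add (intervalIntegral.continuous_primitive h.intervalIntegrable 0)

theorem absolutelyContinuousOnInterval (h : IsPrimitive F f) (a b : ℝ) :
    AbsolutelyContinuousOnInterval F a b := by
  rw [h.eq_add_integral a]
  exact contDiff_const.contDiffOn.absolutelyContinuousOnInterval.add
    ((h.intervalIntegrable a b).absolutelyContinuousOnInterval_intervalIntegral left_mem_uIcc)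

theorem ae_hasDerivAt (h : IsPrimitive F f) : ∀ᵐ x, HasDerivAt F (f x) x := by
  filter_upwards [_root_.LocallyIntegrable.ae_hasDerivAt_integral h.locallyIntegrable] with x hx
  rw [h.eq_add_integral 0]
  exact (hx 0).const_add (F 0)

theorem mul (hF : IsPrimitive F f) (hG : IsPrimitive G g) :
    IsPrimitive (fun x => F x * G x) fun x => f x * G x + F x * g x where
  locallyIntegrable := by
    refine LocallyIntegrable.add ?_ ?_
    · simpa only [mul_comm, smul_eq_mul] using hF.locallyIntegrable.continuous_smul hG.continuous
    · exact hG.locallyIntegrable.continuous_smul hF.continuous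
  sub_eq_integral a b := by
    rw [← (hF.absolutelyContinuousOnInterval a b).integral_deriv_mul_eq_sub
      (hG.absolutelyContinuousOnInterval a b)]
    refine intervalIntegral.integral_congr_ae ?_
    filter_upwards [hF.ae_hasDerivAt, hG.ae_hasDerivAt] with x hFx hGx _
    rw [hFx.deriv, hGx.deriv]

theorem integral_eq_zero (h : IsPrimitive F f) {K : Set ℝ} (hK : IsCompact K)
    (hF : ∀ x ∉ K, F x = 0) (hf : ∀ x ∉ K, f x = 0) : ∫ x, f x = 0 := by
  obtain ⟨R, hR⟩ := exists_subset_Ioo hK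
  have support_subset : Function.support f ⊆ Ioc (-R) R := fun x hx =>
    Ioo_subset_Ioc_self (hR (by_contra fun hxK => hx (hf x hxK)))
  rw [← intervalIntegral.integral_eq_integral_of_support_subset support_subset,
    ← h.sub_eq_integral, hF R fun h => (hR h).2.false, hF (-R) fun h => (hR h).1.false, sub_zero]

theorem isWeakDeriv (h : IsPrimitive F f) : IsWeakDeriv F f := by
  intro φ hφ hs
  have integral_zero : ∫ x, (f x * φ x + F x * deriv φ x) = 0 := by
    refine (h.mul (of_contDiff (hφ.of_le (by simp)))).integral_eq_zero hs.isCompact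
      (fun x hx => ?_) fun x hx => ?_
    · rw [image_eq_zero_of_notMem_tsupport hx, mul_zero]
    · rw [image_eq_zero_of_notMem_tsupport hx,
        image_eq_zero_of_notMem_tsupport fun h => hx (tsupport_deriv_subset h), mul_zero,
        mul_zero, add_zero]
  rw [integral_add (integrable_mul_testFunction h.locallyIntegrable hφ.continuous hs)
    (integrable_mul_testFunction h.continuous.locallyIntegrable
      (hφ.continuous_deriv (by simp)) hs.deriv)] at integral_zero
  linarith

end IsPrimitive

theorem IsWeakDeriv.congr_ae {f f' g g' : ℝ → ℝ} (h : IsWeakDeriv f g) (hf : f =ᵐ[volume] f')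
    (hg : g =ᵐ[volume] g') : IsWeakDeriv f' g' := by
  intro φ hφ hs
  have hf_int : ∫ x, f' x * deriv φ x = ∫ x, f x * deriv φ x :=
    integral_congr_ae (by filter_upwards [hf] with x hx; rw [hx])
  have hg_int : ∫ x, g' x * φ x = ∫ x, g x * φ x :=
    integral_congr_ae (by filter_upwards [hg] with x hx; rw [hx])
  rw [hf_int, hg_int, h φ hφ hs]

theorem exists_testFunction_deriv_eq {ψ : ℝ → ℝ} (hψ : ContDiff ℝ ∞ ψ) (hs : HasCompactSupport ψ)
    (h0 : ∫ x, ψ x = 0) : ∃ φ : ℝ → ℝ, ContDiff ℝ ∞ φ ∧ HasCompactSupport φ ∧ deriv φ = ψ := by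
  obtain ⟨R, hR⟩ := exists_subset_Ioo hs.isCompact
  have vanish : ∀ x ∉ Ioo (-R) R, ψ x = 0 := fun x hx =>
    image_eq_zero_of_notMem_tsupport fun hx' => hx (hR hx')
  have integrable : Integrable ψ := hψ.continuous.integrable_of_hasCompactSupport hs
  have hasDerivAt (x : ℝ) : HasDerivAt (fun x => ∫ t in Iic x, ψ t) (ψ x) x := by
    have eq_add (y : ℝ) : ∫ t in Iic y, ψ t = (∫ t in Iic 0, ψ t) + ∫ t in (0 : ℝ)..y, ψ t := by
      rw [← intervalIntegral.integral_Iic_sub_Iic integrable.integrableOn integrable.integrableOn,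
        add_sub_cancel]
    rw [funext eq_add]
    exact (intervalIntegral.integral_hasDerivAt_right (hψ.continuous.intervalIntegrable _ _)
      (hψ.continuous.stronglyMeasurableAtFilter _ _) hψ.continuous.continuousAt).const_add _
  have deriv_eq : deriv (fun x => ∫ t in Iic x, ψ t) = ψ := funext fun x => (hasDerivAt x).deriv
  refine ⟨fun x => ∫ t in Iic x, ψ t, ?_, ?_, deriv_eq⟩
  · rw [contDiff_infty_iff_deriv, deriv_eq]
    exact ⟨fun x => (hasDerivAt x).differentiableAt, hψ⟩
  · refine HasCompactSupport.intro (isCompact_Icc (a := -R) (b := R)) fun x hx => ?_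
    rcases lt_or_ge x (-R) with hxR | hxR
    · exact setIntegral_eq_zero_of_forall_eq_zero fun t ht =>
        vanish t fun ht' => (ht'.1.trans_le ht).not_gt hxR
    · have hRx : R < x := lt_of_not_ge fun h => hx ⟨hxR, h⟩
      rw [setIntegral_eq_integral_of_forall_compl_eq_zero, h0]
      exact fun t ht => vanish t fun ht' => ht (ht'.2.trans hRx).le

/-- A du Bois-Reymond lemma: `h` is constant because every test function is, up to a multiple of a
fixed bump of integral one, the derivative of a test function. -/
theorem ae_eq_const_of_isWeakDeriv_zero {h : ℝ → ℝ} (hh : LocallyIntegrable h volume)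
    (h0 : IsWeakDeriv h 0) : ∃ c : ℝ, ∀ᵐ x, h x = c := by
  obtain ⟨ρ, hρ, hρs, hρ1⟩ :
      ∃ ρ : ℝ → ℝ, ContDiff ℝ ∞ ρ ∧ HasCompactSupport ρ ∧ ∫ x, ρ x = 1 :=
    let B : ContDiffBump (0 : ℝ) := default
    ⟨B.normed volume, B.contDiff_normed, B.hasCompactSupport_normed, B.integral_normed⟩
  refine ⟨∫ x, h x * ρ x,
    ae_eq_of_integral_contDiff_smul_eq hh (locallyIntegrable_const _) fun ψ hψ hs => ?_⟩
  have hψ_int : Integrable ψ := hψ.continuous.integrable_of_hasCompactSupport hs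
  have hρ_int : Integrable fun x => (∫ y, ψ y) * ρ x :=
    (hρ.continuous.integrable_of_hasCompactSupport hρs).const_mul _
  obtain ⟨φ, hφ, hφs, hd⟩ := exists_testFunction_deriv_eq
    (hψ.sub (contDiff_const (c := ∫ y, ψ y).mul hρ)) (hs.sub hρs.mul_left)
    (by rw [integral_sub hψ_int hρ_int, integral_const_mul, hρ1, mul_one, sub_self])
  have pairing_zero : (∫ x, h x * ψ x) - (∫ y, ψ y) * ∫ x, h x * ρ x = 0 := by
    rw [← integral_const_mul, ← integral_sub (integrable_mul_testFunction hh hψ.continuous hs)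
      ((integrable_mul_testFunction hh hρ.continuous hρs).const_mul _)]
    have h_deriv := h0 φ hφ hφs
    simp only [hd, Pi.zero_apply, zero_mul, integral_zero, neg_zero] at h_deriv
    refine (integral_congr_ae (.of_forall fun x => ?_)).trans h_deriv
    ring
  simp only [smul_eq_mul, mul_comm (ψ _), integral_const_mul]
  rw [sub_eq_zero.1 pairing_zero, mul_comm]

theorem IsWeakDeriv.exists_isPrimitive {f g : ℝ → ℝ} (h : IsWeakDeriv f g)
    (hf : LocallyIntegrable f volume) (hg : LocallyIntegrable g volume) :
    ∃ F : ℝ → ℝ, IsPrimitive F g ∧ f =ᵐ[volume] F := by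
  have hG : IsPrimitive (fun x => ∫ t in (0 : ℝ)..x, g t) g :=
    .of_locallyIntegrable hg 0
  have weakDeriv_sub : IsWeakDeriv (fun x => f x - ∫ t in (0 : ℝ)..x, g t) 0 := by
    intro φ hφ hs
    have hφ' : Continuous (deriv φ) := hφ.continuous_deriv (by simp)
    simp only [sub_mul, Pi.zero_apply, zero_mul, integral_zero, neg_zero]
    rw [integral_sub (integrable_mul_testFunction hf hφ' hs.deriv)
      (integrable_mul_testFunction hG.continuous.locallyIntegrable hφ' hs.deriv), h φ hφ hs,
      hG.isWeakDeriv φ hφ hs, sub_self]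
  obtain ⟨c, hc⟩ := ae_eq_const_of_isWeakDeriv_zero
    (hf.sub hG.continuous.locallyIntegrable) weakDeriv_sub
  refine ⟨fun x => c + ∫ t in (0 : ℝ)..x, g t, hG.const_add c, ?_⟩
  filter_upwards [hc] with x hx
  exact sub_eq_iff_eq_add.1 hx

/-- The element of `H¹` with given underlying function and weak derivative. -/
def H1.mk (f g : L2) (h : IsWeakDeriv f g) : H1 := ⟨WithLp.toLp 2 (f, g), h⟩

/-- The underlying function, as a continuous linear map. -/
noncomputable def H1.fnL : H1 →L[ℝ] L2 := (WithLp.fstL 2 ℝ L2 L2).comp H1Submodule.subtypeL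

/-- The weak derivative, as a continuous linear map. -/
noncomputable def H1.dxL : H1 →L[ℝ] L2 := (WithLp.sndL 2 ℝ L2 L2).comp H1Submodule.subtypeL

namespace H1

theorem isWeakDeriv (f : H1) : IsWeakDeriv f.fn f.dx := f.2

theorem norm_sq_eq (f : H1) : ‖f‖ ^ 2 = ‖f.fn‖ ^ 2 + ‖f.dx‖ ^ 2 :=
  WithLp.prod_norm_sq_eq_of_L2 (f : WithLp 2 (L2 × L2))

theorem norm_fn_le (f : H1) : ‖f.fn‖ ≤ ‖f‖ := WithLp.norm_fst_le _ _

theorem norm_dx_le (f : H1) : ‖f.dx‖ ≤ ‖f‖ := WithLp.norm_snd_le _ _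

theorem norm_le (f : H1) : ‖f‖ ≤ ‖f.fn‖ + ‖f.dx‖ := by
  refine le_of_sq_le_sq ?_ (by positivity)
  nlinarith [f.norm_sq_eq, mul_nonneg (norm_nonneg f.fn) (norm_nonneg f.dx)]

end H1

theorem continuous_integral_mul {ψ : ℝ → ℝ} (hψ : MemLp ψ 2 volume) :
    Continuous fun f : L2 => ∫ x, f x * ψ x := by
  have eq_inner (f : L2) : ∫ x, f x * ψ x = inner ℝ f (hψ.toLp ψ) := by
    rw [L2.inner_eq]
    refine integral_congr_ae ?_
    filter_upwards [hψ.coeFn_toLp] with x hx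
    rw [hx]
  simp only [eq_inner]
  fun_prop

theorem isClosed_H1Submodule : IsClosed (H1Submodule : Set (WithLp 2 (L2 × L2))) := by
  have eq_iInter : (H1Submodule : Set (WithLp 2 (L2 × L2))) =
      ⋂ (φ : ℝ → ℝ) (_ : ContDiff ℝ ∞ φ) (_ : HasCompactSupport φ),
        {p | ∫ x, p.fst x * deriv φ x = -∫ x, p.snd x * φ x} := by
    ext p
    simp only [mem_iInter]
    exact Iff.rfl
  rw [eq_iInter]
  refine isClosed_iInter fun φ => isClosed_iInter fun hφ => isClosed_iInter fun hs => ?_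
  have hφ' : MemLp (deriv φ) 2 volume :=
    (hφ.continuous_deriv (by simp)).memLp_of_hasCompactSupport hs.deriv
  exact isClosed_eq ((continuous_integral_mul hφ').comp (WithLp.continuous_fst 2 L2 L2))
    ((continuous_integral_mul (hφ.continuous.memLp_of_hasCompactSupport hs)).comp
      (WithLp.continuous_snd 2 L2 L2)).neg

instance : CompleteSpace H1 := isClosed_H1Submodule.completeSpace_coe

namespace H1

theorem exists_isPrimitive (f : H1) : ∃ F : ℝ → ℝ, IsPrimitive F f.dx ∧ f.fn =ᵐ[volume] F :=
  f.isWeakDeriv.exists_isPrimitive (L2.locallyIntegrable _) (L2.locallyIntegrable _)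

/-- The continuous representative of an element of `H¹`. -/
noncomputable def rep (f : H1) : ℝ → ℝ := f.exists_isPrimitive.choose

theorem isPrimitive_rep (f : H1) : IsPrimitive f.rep f.dx := f.exists_isPrimitive.choose_spec.1

theorem fn_ae_eq_rep (f : H1) : f.fn =ᵐ[volume] f.rep := f.exists_isPrimitive.choose_spec.2

theorem continuous_rep (f : H1) : Continuous f.rep := f.isPrimitive_rep.continuous

theorem memLp_rep (f : H1) : MemLp f.rep 2 volume := (memLp_congr_ae f.fn_ae_eq_rep).1 (Lp.memLp _)

theorem rep_eq_of_ae_eq {f : H1} {F : ℝ → ℝ} (hF : Continuous F) (h : f.fn =ᵐ[volume] F) :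
    f.rep = F :=
  (f.continuous_rep.ae_eq_iff_eq volume hF).1 (f.fn_ae_eq_rep.symm.trans h)

theorem ext_rep {f g : H1} (h : f.rep = g.rep) : f = g := by
  have hfn : f.fn = g.fn := Lp.ext (f.fn_ae_eq_rep.trans (h ▸ g.fn_ae_eq_rep.symm))
  have hdx : f.dx = g.dx := by
    refine Lp.ext ?_
    filter_upwards [f.isPrimitive_rep.ae_hasDerivAt, g.isPrimitive_rep.ae_hasDerivAt] with x hf hg
    exact hf.unique (h ▸ hg)
  exact Subtype.ext (WithLp.ofLp_injective 2 (Prod.ext hfn hdx))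

theorem ext_fn {f g : H1} (h : f.fn =ᵐ[volume] g.fn) : f = g :=
  ext_rep (rep_eq_of_ae_eq g.continuous_rep (h.trans g.fn_ae_eq_rep))

theorem rep_add (f g : H1) : (f + g).rep = f.rep + g.rep :=
  rep_eq_of_ae_eq (f.continuous_rep.add g.continuous_rep)
    ((Lp.coeFn_add f.fn g.fn).trans (f.fn_ae_eq_rep.add g.fn_ae_eq_rep))

theorem rep_smul (c : ℝ) (f : H1) : (c • f).rep = c • f.rep :=
  rep_eq_of_ae_eq (f.continuous_rep.const_smul c)
    ((Lp.coeFn_smul c f.fn).trans (f.fn_ae_eq_rep.const_smul c))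

theorem abs_rep_sub_le (f : H1) {a b : ℝ} (hab : a ≤ b) :
    |f.rep b - f.rep a| ≤ √(b - a) * ‖f.dx‖ := by
  rw [f.isPrimitive_rep.sub_eq_integral]
  exact L2.abs_intervalIntegral_le _ hab

theorem sqrt_mul_abs_rep_le (f : H1) {l : ℝ} (hl : 0 < l) (x : ℝ) :
    √l * |f.rep x| ≤ ‖f.fn‖ + l * ‖f.dx‖ := by
  have integral_fn_le : |∫ y in x..x + l, f.rep y| ≤ √l * ‖f.fn‖ := by
    rw [← intervalIntegral.integral_congr_ae (f.fn_ae_eq_rep.mono fun y hy _ => hy)]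
    simpa using L2.abs_intervalIntegral_le f.fn (le_add_of_nonneg_right hl.le : x ≤ x + l)
  have integral_sub_le : |∫ y in x..x + l, (f.rep y - f.rep x)| ≤ √l * ‖f.dx‖ * l := by
    have bound (y : ℝ) (hy : y ∈ uIoc x (x + l)) : ‖f.rep y - f.rep x‖ ≤ √l * ‖f.dx‖ := by
      rw [uIoc_of_le (by linarith)] at hy
      refine (f.abs_rep_sub_le hy.1.le).trans ?_
      gcongr
      linarith [hy.2]
    simpa [abs_of_pos hl] using intervalIntegral.norm_integral_le_of_norm_le_const bound
  have average : l * f.rep x =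
      (∫ y in x..x + l, f.rep y) - ∫ y in x..x + l, (f.rep y - f.rep x) := by
    rw [intervalIntegral.integral_sub (f.continuous_rep.intervalIntegrable _ _) (by simp)]
    simp
  refine le_of_mul_le_mul_left ?_ (Real.sqrt_pos.2 hl)
  calc √l * (√l * |f.rep x|) = |l * f.rep x| := by
        rw [← mul_assoc, Real.mul_self_sqrt hl.le, abs_mul, abs_of_pos hl]
    _ ≤ √l * ‖f.fn‖ + √l * ‖f.dx‖ * l := by
        rw [average]
        exact (abs_sub _ _).trans (add_le_add integral_fn_le integral_sub_le)
    _ = √l * (‖f.fn‖ + l * ‖f.dx‖) := by ring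

theorem abs_rep_le (f : H1) (x : ℝ) : |f.rep x| ≤ ‖f.fn‖ + ‖f.dx‖ := by
  simpa using f.sqrt_mul_abs_rep_le one_pos x

theorem abs_rep_le_norm (f : H1) (x : ℝ) : |f.rep x| ≤ 2 * ‖f‖ := by
  linarith [f.abs_rep_le x, f.norm_fn_le, f.norm_dx_le]

/-- Evaluation of the continuous representative at a point. -/
noncomputable def evalL (x : ℝ) : H1 →L[ℝ] ℝ :=
  LinearMap.mkContinuous
    { toFun := fun f => f.rep x
      map_add' := fun f g => by rw [rep_add, Pi.add_apply]
      map_smul' := fun c f => by rw [rep_smul, Pi.smul_apply, RingHom.id_apply] }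
    2 fun f => f.abs_rep_le_norm x

@[simp] theorem evalL_apply (x : ℝ) (f : H1) : evalL x f = f.rep x := rfl

theorem memLp_rep_mul (f : H1) (g : L2) : MemLp (fun x => f.rep x * g x) 2 volume := by
  refine (Lp.memLp g).of_le_mul (c := 2 * ‖f‖)
    (f.continuous_rep.aestronglyMeasurable.mul (Lp.memLp g).1) (.of_forall fun x => ?_)
  rw [norm_mul]
  exact mul_le_mul_of_nonneg_right (f.abs_rep_le_norm x) (norm_nonneg _)

/-- The product of an element of `H¹`, which is a bounded function, and an `L²` function. -/
noncomputable def mulL2 (f : H1) (g : L2) : L2 := (f.memLp_rep_mul g).toLp _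

theorem coeFn_mulL2 (f : H1) (g : L2) : f.mulL2 g =ᵐ[volume] fun x => f.rep x * g x :=
  MemLp.coeFn_toLp _

theorem norm_mulL2_le {f : H1} {C : ℝ} (hC : ∀ x, |f.rep x| ≤ C) (g : L2) :
    ‖f.mulL2 g‖ ≤ C * ‖g‖ := by
  refine Lp.norm_le_mul_norm_of_ae_le_mul ?_
  filter_upwards [f.coeFn_mulL2 g] with x hx
  rw [hx, norm_mul]
  exact mul_le_mul_of_nonneg_right (hC x) (norm_nonneg _)

theorem coeFn_mulL2_add_mulL2 (f g : H1) : (g.mulL2 f.dx + f.mulL2 g.dx : L2) =ᵐ[volume]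
    fun x => f.dx x * g.rep x + f.rep x * g.dx x := by
  filter_upwards [Lp.coeFn_add (g.mulL2 f.dx) (f.mulL2 g.dx), g.coeFn_mulL2 f.dx,
    f.coeFn_mulL2 g.dx] with x h_add hg hf
  rw [h_add, Pi.add_apply, hg, hf, mul_comm (g.rep x)]

theorem isWeakDeriv_mul (f g : H1) :
    IsWeakDeriv (f.mulL2 g.fn) (g.mulL2 f.dx + f.mulL2 g.dx : L2) := by
  refine (f.isPrimitive_rep.mul g.isPrimitive_rep).isWeakDeriv.congr_ae ?_
    (f.coeFn_mulL2_add_mulL2 g).symm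
  filter_upwards [f.coeFn_mulL2 g.fn, g.fn_ae_eq_rep] with x hfg hg
  rw [hfg, hg]

/-- The product of two elements of `H¹`. -/
noncomputable def mul (f g : H1) : H1 := H1.mk _ _ (f.isWeakDeriv_mul g)

theorem rep_mul (f g : H1) : (f.mul g).rep = fun x => f.rep x * g.rep x := by
  refine rep_eq_of_ae_eq (f.continuous_rep.mul g.continuous_rep) ?_
  filter_upwards [f.coeFn_mulL2 g.fn, g.fn_ae_eq_rep] with x hfg hg
  rw [← hg, ← hfg]
  rfl

theorem norm_mul_le (f g : H1) : ‖f.mul g‖ ≤ 6 * ‖f‖ * ‖g‖ :=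
  calc ‖f.mul g‖ ≤ ‖f.mulL2 g.fn‖ + ‖g.mulL2 f.dx + f.mulL2 g.dx‖ := (f.mul g).norm_le
    _ ≤ 2 * ‖f‖ * ‖g.fn‖ + (2 * ‖g‖ * ‖f.dx‖ + 2 * ‖f‖ * ‖g.dx‖) :=
        add_le_add (norm_mulL2_le f.abs_rep_le_norm _) ((norm_add_le _ _).trans
          (add_le_add (norm_mulL2_le g.abs_rep_le_norm _) (norm_mulL2_le f.abs_rep_le_norm _)))
    _ ≤ 2 * ‖f‖ * ‖g‖ + (2 * ‖g‖ * ‖f‖ + 2 * ‖f‖ * ‖g‖) := by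
        have hg_fn := g.norm_fn_le
        have hg_dx := g.norm_dx_le
        have hf_dx := f.norm_dx_le
        gcongr
    _ = 6 * ‖f‖ * ‖g‖ := by ring

/-- Multiplication on `H¹`, as a continuous bilinear map. -/
noncomputable def mulL : H1 →L[ℝ] H1 →L[ℝ] H1 :=
  LinearMap.mkContinuous₂
    (LinearMap.mk₂ ℝ mul
      (fun f g h => ext_rep (by
        simp only [rep_mul, rep_add, Pi.add_apply, add_mul]
        rfl))
      (fun c f g => ext_rep (by
        simp only [rep_mul, rep_smul, Pi.smul_apply, smul_eq_mul, mul_assoc]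
        rfl))
      (fun f g h => ext_rep (by
        simp only [rep_mul, rep_add, Pi.add_apply, mul_add]
        rfl))
      (fun c f g => ext_rep (by
        simp only [rep_mul, rep_smul, Pi.smul_apply, smul_eq_mul, mul_left_comm]
        rfl)))
    6 norm_mul_le

@[simp] theorem mulL_apply (f g : H1) : mulL f g = f.mul g := rfl

end H1

section Fourier

open FourierTransform RealInnerProductSpace ComplexConjugate

variable {V : Type*} [NormedAddCommGroup V] [InnerProductSpace ℝ V] [FiniteDimensional ℝ V]
  [MeasurableSpace V] [BorelSpace V]

theorem memLp_two_of_norm_le {m : V → ℂ} (m_int : Integrable m) {C : ℝ} (m_le : ∀ ξ, ‖m ξ‖ ≤ C) :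
    MemLp m 2 volume := by
  refine (memLp_two_iff_integrable_sq_norm m_int.1).2
    ((m_int.norm.const_mul C).mono (m_int.1.norm.pow 2) (.of_forall fun ξ => ?_))
  rw [Real.norm_of_nonneg (sq_nonneg _), sq]
  exact (mul_le_mul_of_nonneg_right (m_le ξ) (norm_nonneg _)).trans (le_abs_self _)

theorem coeFn_fourier_toLp_ae_eq {h : V → ℂ} (h_int : Integrable h) (h_sq : MemLp h 2 volume) :
    (𝓕 (h_sq.toLp h) : Lp ℂ 2 (volume : Measure V)) =ᵐ[volume] 𝓕 h := by
  have continuous_fourier : Continuous (𝓕 h) :=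
    VectorFourier.fourierIntegral_continuous Real.continuous_fourierChar continuous_inner h_int
  refine ae_eq_of_integral_contDiff_smul_eq ((Lp.memLp _).locallyIntegrable (by norm_num))
    continuous_fourier.locallyIntegrable fun ψ hψ hs => ?_
  have complex_support : HasCompactSupport (Complex.ofRealCLM ∘ ψ) := hs.comp_left rfl
  set Ψ : SchwartzMap V ℂ := complex_support.toSchwartzMap (by fun_prop) with hΨ
  have Ψ_smul (g : V → ℂ) : ∫ x, ψ x • g x = ∫ x, Ψ x • g x := by
    simp [hΨ]
  rw [Ψ_smul, Ψ_smul]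
  calc ∫ x, Ψ x • (𝓕 (h_sq.toLp h) : Lp ℂ 2 (volume : Measure V)) x
      = Lp.toTemperedDistribution (𝓕 (h_sq.toLp h) : Lp ℂ 2 (volume : Measure V)) Ψ :=
        (Lp.toTemperedDistribution_apply _ _).symm
    _ = ∫ ξ, (𝓕 Ψ) ξ • (h_sq.toLp h : Lp ℂ 2 (volume : Measure V)) ξ := by
        rw [← Lp.fourier_toTemperedDistribution_eq, TemperedDistribution.fourier_apply,
          Lp.toTemperedDistribution_apply]
    _ = ∫ ξ, (𝓕 Ψ) ξ • h ξ := by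
        refine integral_congr_ae ?_
        filter_upwards [h_sq.coeFn_toLp] with ξ hξ
        rw [hξ]
    _ = ∫ x, Ψ x • 𝓕 h x := by
        rw [SchwartzMap.fourier_coe]
        have self_adjoint := VectorFourier.integral_fourierIntegral_smul_eq_flip (L := innerₗ V)
          (μ := volume) Real.continuous_fourierChar continuous_inner Ψ.integrable h_int
        rwa [flip_innerₗ] at self_adjoint

theorem integral_fourier_sub_mul_fourier {m : V → ℂ} (m_int : Integrable m)
    (m_sq : MemLp m 2 volume) (z : Lp ℂ 2 (volume : Measure V)) (x : V) :
    ∫ y, 𝓕 m (x - y) * (𝓕 z : Lp ℂ 2 (volume : Measure V)) y = 𝓕 (fun ξ => m ξ * z ξ) x := by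
  set n : V → ℂ := fun ξ => Real.fourierChar ⟪ξ, x⟫ • conj (m ξ) with hn
  have norm_n (ξ : V) : ‖n ξ‖ = ‖m ξ‖ := by simp [hn, Circle.norm_smul]
  have n_meas : AEStronglyMeasurable n volume := by
    have := m_sq.1
    fun_prop
  have n_int : Integrable n := m_int.congr' n_meas (.of_forall fun ξ => (norm_n ξ).symm)
  have n_sq : MemLp n 2 volume := m_sq.congr_norm n_meas (.of_forall fun ξ => (norm_n ξ).symm)
  have fourier_n (y : V) : 𝓕 n y = conj (𝓕 m (x - y)) := by
    rw [Real.fourier_eq, Real.fourier_eq, ← integral_conj]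
    refine integral_congr_ae (.of_forall fun ξ => ?_)
    simp only [hn, smul_smul, ← AddChar.map_add_eq_mul]
    simp only [Circle.smul_def, smul_eq_mul, map_mul, ← Circle.coe_inv_eq_conj,
      ← AddChar.map_neg_eq_inv, inner_sub_right, neg_sub', sub_neg_eq_add,
      neg_add_eq_sub]
  calc ∫ y, 𝓕 m (x - y) * (𝓕 z : Lp ℂ 2 (volume : Measure V)) y
      = inner ℂ (𝓕 (n_sq.toLp n)) (𝓕 z) := by
        rw [L2.inner_def]
        refine integral_congr_ae ?_
        filter_upwards [coeFn_fourier_toLp_ae_eq n_int n_sq] with y hy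
        rw [hy, fourier_n, RCLike.inner_apply, RCLike.conj_conj, mul_comm]
    _ = inner ℂ (n_sq.toLp n) z := Lp.inner_fourier_eq _ _
    _ = 𝓕 (fun ξ => m ξ * z ξ) x := by
        rw [L2.inner_def, Real.fourier_eq]
        refine integral_congr_ae ?_
        filter_upwards [n_sq.coeFn_toLp] with ξ hξ
        rw [hξ, RCLike.inner_apply, AddChar.map_neg_eq_inv]
        simp only [hn, Circle.smul_def, smul_eq_mul, map_mul, RCLike.conj_conj,
          Circle.coe_inv_eq_conj]
        ring

/-- Convolution with `𝓕 m` is the Fourier multiplier of symbol `m`, so by Plancherel its norm on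
`L²` is at most `sup ‖m‖`. -/
theorem exists_coeFn_eq_integral_fourier_sub_mul {m : V → ℂ} (m_int : Integrable m) {C : ℝ}
    (m_le : ∀ ξ, ‖m ξ‖ ≤ C) (w : Lp ℂ 2 (volume : Measure V)) :
    ∃ g : Lp ℂ 2 (volume : Measure V), ‖g‖ ≤ C * ‖w‖ ∧
      g =ᵐ[volume] fun x => ∫ y, 𝓕 m (x - y) * w y := by
  have m_sq : MemLp m 2 volume := memLp_two_of_norm_le m_int m_le
  obtain ⟨z, rfl⟩ : ∃ z : Lp ℂ 2 (volume : Measure V), 𝓕 z = w := ⟨𝓕⁻ w, fourier_fourierInv_eq w⟩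
  have mul_int : Integrable fun ξ => m ξ * z ξ := m_sq.integrable_mul (q := 2) (Lp.memLp z)
  have norm_mul_le (ξ : V) : ‖m ξ * z ξ‖ ≤ C * ‖z ξ‖ := by
    rw [norm_mul]
    exact mul_le_mul_of_nonneg_right (m_le ξ) (norm_nonneg _)
  have mul_sq : MemLp (fun ξ => m ξ * z ξ) 2 volume :=
    (Lp.memLp z).of_le_mul mul_int.1 (.of_forall norm_mul_le)
  refine ⟨𝓕 (mul_sq.toLp _), ?_, ?_⟩
  · rw [Lp.norm_fourier_eq, Lp.norm_fourier_eq]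
    refine Lp.norm_le_mul_norm_of_ae_le_mul ?_
    filter_upwards [mul_sq.coeFn_toLp] with ξ hξ
    rw [hξ]
    exact norm_mul_le ξ
  · filter_upwards [coeFn_fourier_toLp_ae_eq mul_int mul_sq] with x hx
    rw [hx, integral_fourier_sub_mul_fourier m_int m_sq]

end Fourier

/-- The conjugate Poisson kernel of the upper half plane, at height `η`. -/
noncomputable def conjKernel (η s : ℝ) : ℝ := Real.pi⁻¹ * (s / (s ^ 2 + η ^ 2))

section Symbol

open FourierTransform

/-- The Fourier multiplier `i sign(ξ) e^{-2πη|ξ|}` of convolution with the conjugate Poisson kernel.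
The sign of the exponent in `𝓕` makes this the conjugate of the usual symbol of the kernel. -/
noncomputable def conjSymbol (η ξ : ℝ) : ℂ :=
  if ξ ≤ 0 then -Complex.I * Complex.exp ((2 * Real.pi * η : ℝ) * ξ)
  else Complex.I * Complex.exp ((-(2 * Real.pi * η) : ℝ) * ξ)

theorem norm_conjSymbol_le {η : ℝ} (hη : 0 ≤ η) (ξ : ℝ) : ‖conjSymbol η ξ‖ ≤ 1 := by
  have hc : 0 ≤ 2 * Real.pi * η := by positivity
  unfold conjSymbol
  split_ifs with hξ
  · simpa [Complex.norm_exp] using mul_nonpos_of_nonneg_of_nonpos hc hξ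
  · simpa [Complex.norm_exp] using mul_nonneg hc (not_le.1 hξ).le

theorem integrable_conjSymbol {η : ℝ} (hη : 0 < η) : Integrable (conjSymbol η) := by
  have hc : 0 < 2 * Real.pi * η := by positivity
  rw [← integrableOn_univ, ← Iic_union_Ioi (a := 0), integrableOn_union]
  constructor
  · refine IntegrableOn.congr_fun ((integrableOn_exp_mul_complex_Iic
      (a := (2 * Real.pi * η : ℝ)) hc 0).const_mul (-Complex.I)) (fun ξ hξ => ?_) measurableSet_Iic
    exact (if_pos hξ).symm
  · refine IntegrableOn.congr_fun ((integrableOn_exp_mul_complex_Ioi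
      (a := (-(2 * Real.pi * η) : ℝ)) (neg_lt_zero.2 hc) 0).const_mul Complex.I)
      (fun ξ hξ => ?_) measurableSet_Ioi
    exact (if_neg (not_le.2 hξ)).symm

theorem exp_smul_conjSymbol_of_nonpos (η s : ℝ) {ξ : ℝ} (hξ : ξ ≤ 0) :
    Complex.exp (↑(-2 * Real.pi * ξ * s) * Complex.I) • conjSymbol η ξ =
      -Complex.I * Complex.exp ((2 * Real.pi * η - 2 * Real.pi * s * Complex.I) * ξ) := by
  rw [conjSymbol, if_pos hξ, smul_eq_mul, mul_left_comm, ← Complex.exp_add]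
  congr 2
  push_cast
  ring

theorem exp_smul_conjSymbol_of_pos (η s : ℝ) {ξ : ℝ} (hξ : 0 < ξ) :
    Complex.exp (↑(-2 * Real.pi * ξ * s) * Complex.I) • conjSymbol η ξ =
      Complex.I * Complex.exp ((-(2 * Real.pi * η) - 2 * Real.pi * s * Complex.I) * ξ) := by
  rw [conjSymbol, if_neg (not_le.2 hξ), smul_eq_mul, mul_left_comm, ← Complex.exp_add]
  congr 2
  push_cast
  ring

theorem fourier_conjSymbol {η : ℝ} (hη : 0 < η) (s : ℝ) :
    𝓕 (conjSymbol η) s = conjKernel η s := by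
  have hc : 0 < 2 * Real.pi * η := by positivity
  have left := fun ξ (hξ : ξ ∈ Iic (0 : ℝ)) => exp_smul_conjSymbol_of_nonpos η s hξ
  have right := fun ξ (hξ : ξ ∈ Ioi (0 : ℝ)) => exp_smul_conjSymbol_of_pos η s hξ
  set z : ℂ := 2 * Real.pi * η - 2 * Real.pi * s * Complex.I with hz
  set w : ℂ := -(2 * Real.pi * η) - 2 * Real.pi * s * Complex.I with hw
  have z_re : 0 < z.re := by simpa [hz] using hc
  have w_re : w.re < 0 := by simpa [hw] using hc
  have z_ne : z ≠ 0 := fun h => z_re.ne' (by rw [h, Complex.zero_re])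
  have w_ne : w ≠ 0 := fun h => w_re.ne (by rw [h, Complex.zero_re])
  have zw : z * w = -((2 * Real.pi) ^ 2 * (s ^ 2 + η ^ 2)) := by
    rw [hz, hw]
    linear_combination (2 * Real.pi * s) ^ 2 * Complex.I_sq
  have denom_ne : (s : ℂ) ^ 2 + η ^ 2 ≠ 0 := by
    exact_mod_cast (by positivity : s ^ 2 + η ^ 2 ≠ 0)
  have integrable_left :=
    IntegrableOn.congr_fun ((integrableOn_exp_mul_complex_Iic z_re 0).const_mul (-Complex.I))
      (fun ξ hξ => (left ξ hξ).symm) measurableSet_Iic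
  have integrable_right :=
    IntegrableOn.congr_fun ((integrableOn_exp_mul_complex_Ioi w_re 0).const_mul Complex.I)
      (fun ξ hξ => (right ξ hξ).symm) measurableSet_Ioi
  rw [Real.fourier_real_eq_integral_exp_smul, ← intervalIntegral.integral_Iic_add_Ioi
    integrable_left integrable_right, setIntegral_congr_fun measurableSet_Iic left,
    setIntegral_congr_fun measurableSet_Ioi right, integral_const_mul,
    integral_const_mul, integral_exp_mul_complex_Iic z_re, integral_exp_mul_complex_Ioi w_re]
  simp only [Complex.ofReal_zero, mul_zero, Complex.exp_zero, conjKernel]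
  calc -Complex.I * (1 / z) + Complex.I * (-1 / w)
      = -Complex.I * (z + w) / (z * w) := by field_simp; ring
    _ = (4 * Real.pi * s) * Complex.I ^ 2 / (z * w) := by rw [hz, hw]; ring
    _ = _ := by
      rw [zw, Complex.I_sq]
      push_cast
      field_simp
      ring

theorem memLp_conjKernel {η : ℝ} (hη : 0 < η) : MemLp (conjKernel η) 2 volume := by
  have symbol_sq := memLp_two_of_norm_le (integrable_conjSymbol hη) (norm_conjSymbol_le hη.le)
  refine (Lp.memLp (𝓕 (symbol_sq.toLp _) : Lp ℂ 2 (volume : Measure ℝ))).congr_norm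
    (by unfold conjKernel; exact (by fun_prop : Measurable _).aestronglyMeasurable) ?_
  filter_upwards [coeFn_fourier_toLp_ae_eq (integrable_conjSymbol hη) symbol_sq] with s hs
  rw [hs, fourier_conjSymbol hη, Complex.norm_real]

end Symbol

/-- Convolution with the conjugate Poisson kernel. -/
noncomputable def conjConv (η : ℝ) (w : ℝ → ℝ) (x : ℝ) : ℝ := ∫ s, conjKernel η s * w (x - s)

theorem exists_coeFn_eq_conjConv {η : ℝ} (hη : 0 < η) (w : L2) :
    ∃ g : L2, ‖g‖ ≤ ‖w‖ ∧ g =ᵐ[volume] conjConv η w := by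
  set W : Lp ℂ 2 (volume : Measure ℝ) := Complex.ofRealCLM.compLp w
  obtain ⟨G, G_le, hG⟩ := exists_coeFn_eq_integral_fourier_sub_mul (integrable_conjSymbol hη)
    (norm_conjSymbol_le hη.le) W
  have G_eq : G =ᵐ[volume] fun x => (conjConv η w x : ℂ) := by
    filter_upwards [hG] with x hx
    rw [hx, ← integral_sub_left_eq_self _ volume x, conjConv, ← integral_complex_ofReal]
    have W_sub : ∀ᵐ s, W (x - s) = w (x - s) :=
      (Measure.measurePreserving_sub_left volume x).quasiMeasurePreserving.ae
        (Complex.ofRealCLM.coeFn_compLp w)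
    refine integral_congr_ae ?_
    filter_upwards [W_sub] with s hs
    rw [sub_sub_cancel, fourier_conjSymbol hη, hs]
    push_cast
    rfl
  have g_mem : MemLp (conjConv η w) 2 volume := by
    have g_meas : AEStronglyMeasurable (conjConv η w) volume :=
      (Complex.continuous_re.comp_aestronglyMeasurable (Lp.aestronglyMeasurable G)).congr
        (G_eq.mono fun x hx => by simp [hx])
    exact (Lp.memLp G).congr_norm g_meas (G_eq.mono fun x hx => by rw [hx, Complex.norm_real])
  refine ⟨g_mem.toLp _, ?_, g_mem.coeFn_toLp⟩
  have norm_G : ‖g_mem.toLp _‖ = ‖G‖ := by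
    rw [Lp.norm_toLp, Lp.norm_def, eLpNorm_congr_norm_ae
      (G_eq.mono fun x hx => by rw [hx, Complex.norm_real] : ∀ᵐ x, ‖G x‖ = ‖conjConv η w x‖)]
  have norm_W : ‖W‖ = ‖w‖ := by
    rw [Lp.norm_def, Lp.norm_def, eLpNorm_congr_norm_ae ((Complex.ofRealCLM.coeFn_compLp w).mono
      fun x hx => by rw [hx, Complex.ofRealCLM_apply, Complex.norm_real] : ∀ᵐ x, ‖W x‖ = ‖w x‖)]
  rw [norm_G, ← norm_W]
  simpa using G_le

section Convolution

variable {k F g : ℝ → ℝ}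

theorem integrable_mul_comp_sub_left (hk : MemLp k 2 volume) (hg : MemLp g 2 volume) (x : ℝ) :
    Integrable fun s => k s * g (x - s) :=
  hk.integrable_mul (q := 2)
    (hg.comp_measurePreserving (Measure.measurePreserving_sub_left volume x))

theorem integrable_prod_mul_comp_sub (hk : MemLp k 2 volume) (hg : MemLp g 2 volume) (a b : ℝ) :
    Integrable (Function.uncurry fun x s => k s * g (x - s))
      ((volume.restrict (uIoc a b)).prod volume) := by
  have : IsFiniteMeasure (volume.restrict (uIoc a b)) := ⟨by simp [uIoc]⟩
  have shear : MeasurePreserving (fun p : ℝ × ℝ => (p.1, p.1 - p.2))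
      ((volume.restrict (uIoc a b)).prod volume) ((volume.restrict (uIoc a b)).prod volume) :=
    (MeasurePreserving.id _).skew_product (by fun_prop)
      (.of_forall fun x => (Measure.measurePreserving_sub_left volume x).map_eq)
  exact (hk.comp_snd _).integrable_mul (q := 2) ((hg.comp_snd _).comp_measurePreserving shear)

theorem IsPrimitive.convolution (h : IsPrimitive F g) (hk : MemLp k 2 volume)
    (hF : MemLp F 2 volume) (hg : MemLp g 2 volume) :
    IsPrimitive (fun x => ∫ s, k s * F (x - s)) fun x => ∫ s, k s * g (x - s) where
  locallyIntegrable := by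
    rw [locallyIntegrable_iff]
    intro K hK
    obtain ⟨R, hR⟩ := exists_subset_Ioo hK
    exact IntegrableOn.mono_set (integrable_prod_mul_comp_sub hk hg (-R) R).integral_prod_left
      (hR.trans (Ioo_subset_Ioc_self.trans Ioc_subset_uIoc))
  sub_eq_integral a b := by
    rw [intervalIntegral_integral_swap (integrable_prod_mul_comp_sub hk hg a b), ← integral_sub
      (integrable_mul_comp_sub_left hk hF b) (integrable_mul_comp_sub_left hk hF a)]
    refine integral_congr_ae (.of_forall fun s => ?_)
    simp only
    rw [intervalIntegral.integral_const_mul, intervalIntegral.integral_comp_sub_right,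
      ← h.sub_eq_integral, mul_sub]

end Convolution

theorem exists_rep_eq_conjConv {η : ℝ} (hη : 0 < η) (f : H1) :
    ∃ g : H1, ‖g.fn‖ ≤ ‖f.fn‖ ∧ ‖g.dx‖ ≤ ‖f.dx‖ ∧ g.rep = conjConv η f.rep := by
  obtain ⟨F, F_le, hF⟩ := exists_coeFn_eq_conjConv hη f.fn
  obtain ⟨F', F'_le, hF'⟩ := exists_coeFn_eq_conjConv hη f.dx
  have conv_eq : conjConv η f.fn = conjConv η f.rep := by
    ext x
    refine integral_congr_ae ?_
    filter_upwards [(Measure.measurePreserving_sub_left volume x).quasiMeasurePreserving.ae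
      f.fn_ae_eq_rep] with s hs
    rw [hs]
  have primitive : IsPrimitive (conjConv η f.rep) (conjConv η f.dx) :=
    f.isPrimitive_rep.convolution (memLp_conjKernel hη) f.memLp_rep (Lp.memLp f.dx)
  rw [conv_eq] at hF
  exact ⟨H1.mk F F' (primitive.isWeakDeriv.congr_ae hF.symm hF'.symm), F_le, F'_le,
    H1.rep_eq_of_ae_eq primitive.continuous hF⟩

/-- The integrand of the principal value `P.V. ∫ f(x - s) / s ds`, symmetrized in `s`. -/
noncomputable def pvKernel (f : H1) (x s : ℝ) : ℝ := (f.rep (x - s) - f.rep (x + s)) / s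

/-- The principal value `(1/π) P.V. ∫ f(y) / (x - y) dy`. -/
noncomputable def pvIntegral (f : H1) (x : ℝ) : ℝ := (2 * Real.pi)⁻¹ * ∫ s, pvKernel f x s

theorem measurableSet_lt_abs (ε : ℝ) : MeasurableSet {s : ℝ | ε < |s|} :=
  measurableSet_lt measurable_const (by fun_prop)

theorem memLp_indicator_inv {ε : ℝ} (hε : 0 < ε) :
    MemLp ({s : ℝ | ε < |s|}.indicator fun s => s⁻¹) 2 volume := by
  have hm : Measurable ({s : ℝ | ε < |s|}.indicator fun s => s⁻¹) :=
    measurable_inv.indicator (measurableSet_lt_abs ε)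
  refine (memLp_conjKernel hε).of_le_mul (c := 2 * Real.pi) hm.aestronglyMeasurable
    (.of_forall fun s => ?_)
  by_cases hs : s ∈ {s : ℝ | ε < |s|}
  · have s_pos : 0 < |s| := hε.trans hs
    have sq_le : ε ^ 2 ≤ |s| ^ 2 := pow_le_pow_left₀ hε.le (le_of_lt hs) 2
    have denom_pos : 0 < |s| ^ 2 + ε ^ 2 := by positivity
    have := Real.pi_pos
    rw [indicator_of_mem hs, conjKernel, norm_inv, norm_mul, norm_div, norm_inv,
      Real.norm_of_nonneg Real.pi_pos.le, Real.norm_eq_abs, Real.norm_eq_abs, ← sq_abs s,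
      abs_of_pos denom_pos, mul_assoc, mul_inv_cancel_left₀ Real.pi_pos.ne', ← mul_div_assoc,
      inv_eq_one_div, div_le_div_iff₀ s_pos denom_pos]
    linarith
  · rw [indicator_of_notMem hs, norm_zero]
    positivity

namespace H1

variable (f : H1) (x : ℝ)

theorem memLp_rep_add : MemLp (fun s => f.rep (x + s)) 2 volume :=
  f.memLp_rep.comp_measurePreserving (measurePreserving_add_left volume x)

theorem memLp_rep_sub : MemLp (fun s => f.rep (x - s)) 2 volume :=
  f.memLp_rep.comp_measurePreserving (Measure.measurePreserving_sub_left volume x)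

end H1

section PrincipalValue

variable (f : H1) (x : ℝ)

theorem measurable_pvKernel : Measurable (pvKernel f x) := by
  have := f.continuous_rep.measurable
  unfold pvKernel
  fun_prop

/-- The Hölder continuity of `f` makes the singularity at the origin integrable. -/
theorem abs_pvKernel_le (s : ℝ) : |pvKernel f x s| ≤ √2 * ‖f.dx‖ * |s| ^ (-(1 / 2) : ℝ) := by
  rcases eq_or_ne s 0 with rfl | hs
  · simp only [pvKernel, div_zero, abs_zero]
    positivity
  have s_pos : 0 < |s| := abs_pos.2 hs
  have holder : |f.rep (x - s) - f.rep (x + s)| ≤ √(2 * |s|) * ‖f.dx‖ := by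
    rcases le_total 0 s with h | h
    · rw [abs_sub_comm, abs_of_nonneg h]
      convert f.abs_rep_sub_le (show x - s ≤ x + s by linarith) using 3
      ring
    · rw [abs_of_nonpos h]
      convert f.abs_rep_sub_le (show x + s ≤ x - s by linarith) using 3
      ring
  have rpow_eq : |s| ^ (-(1 / 2) : ℝ) = √|s| / |s| := by
    rw [Real.sqrt_eq_rpow, ← Real.rpow_sub_one s_pos.ne']
    norm_num
  rw [pvKernel, abs_div, rpow_eq, mul_div_assoc']
  gcongr
  rwa [mul_right_comm, ← Real.sqrt_mul zero_le_two]

theorem integrable_pvKernel : Integrable (pvKernel f x) := by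
  have near : IntegrableOn (pvKernel f x) (Metric.ball 0 2) :=
    integrableOn_ball_of_norm_le_rpow (α := 1 / 2) (by simp) (by norm_num)
      (ae_restrict_of_ae (.of_forall (abs_pvKernel_le f x)))
      (measurable_pvKernel f x).aestronglyMeasurable
  have far : IntegrableOn (pvKernel f x) {s : ℝ | 1 < |s|} := by
    rw [← integrable_indicator_iff (measurableSet_lt_abs 1)]
    refine ((memLp_indicator_inv one_pos).integrable_mul (q := 2)
      ((f.memLp_rep_sub x).sub (f.memLp_rep_add x))).congr (.of_forall fun s => ?_)
    simp only [pvKernel, Pi.mul_apply, Pi.sub_apply, indicator_apply, ite_mul, zero_mul,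
      inv_mul_eq_div]
  rw [← integrableOn_univ]
  refine (near.union far).mono_set fun s _ => ?_
  rw [mem_union, mem_ball_zero_iff, Real.norm_eq_abs]
  exact (lt_or_ge 1 |s|).symm.imp (fun h => h.trans_lt one_lt_two) id

/-- Symmetrization: for an even weight, the integral against `f(x - s) / s` only sees the odd
part of `s ↦ f(x - s)`. -/
theorem integral_even_weight {k : ℝ → ℝ} (hk : ∀ s, k (-s) = k s)
    (hi : Integrable fun s => k s * (f.rep (x - s) / s)) :
    Real.pi⁻¹ * ∫ s, k s * (f.rep (x - s) / s) = (2 * Real.pi)⁻¹ * ∫ s, k s * pvKernel f x s := by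
  have reflect (s : ℝ) : k (-s) * (f.rep (x - -s) / -s) = -(k s * (f.rep (x + s) / s)) := by
    rw [hk, sub_neg_eq_add, div_neg, mul_neg]
  have int_reflect : Integrable fun s => -(k s * (f.rep (x + s) / s)) :=
    hi.comp_neg.congr (.of_forall reflect)
  have split : ∫ s, k s * pvKernel f x s =
      (∫ s, k s * (f.rep (x - s) / s)) + ∫ s, -(k s * (f.rep (x + s) / s)) := by
    rw [← integral_add hi int_reflect]
    refine integral_congr_ae (.of_forall fun s => ?_)
    simp only [pvKernel]
    ring
  simp only [← reflect] at split
  rw [split, integral_neg_eq_self fun s => k s * (f.rep (x - s) / s), mul_inv]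
  ring

theorem tendsto_integral_weight_mul_pvKernel {k : ℝ → ℝ → ℝ} {l : Filter ℝ}
    [l.IsCountablyGenerated] (k_meas : ∀ ε, Measurable (k ε)) (k_le : ∀ ε s, |k ε s| ≤ 1)
    (k_lim : ∀ s ≠ 0, Tendsto (fun ε => k ε s) l (𝓝 1)) :
    Tendsto (fun ε => (2 * Real.pi)⁻¹ * ∫ s, k ε s * pvKernel f x s) l (𝓝 (pvIntegral f x)) := by
  refine Tendsto.const_mul _ (tendsto_integral_filter_of_dominated_convergence
    (fun s => ‖pvKernel f x s‖) (.of_forall fun ε => ?_)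
    (.of_forall fun ε => .of_forall fun s => ?_) (integrable_pvKernel f x).norm
    (.of_forall fun s => ?_))
  · exact ((k_meas ε).mul (measurable_pvKernel f x)).aestronglyMeasurable
  · rw [norm_mul]
    exact mul_le_of_le_one_left (norm_nonneg _) (k_le ε s)
  · rcases eq_or_ne s 0 with rfl | hs
    · simp only [pvKernel, div_zero, mul_zero, tendsto_const_nhds]
    · simpa only [one_mul] using (k_lim s hs).mul_const (pvKernel f x s)

theorem tendsto_conjConv :
    Tendsto (fun η => conjConv η f.rep x) (𝓝[>] 0) (𝓝 (pvIntegral f x)) := by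
  set k : ℝ → ℝ → ℝ := fun η s => s ^ 2 / (s ^ 2 + η ^ 2)
  have conjKernel_mul (η s : ℝ) :
      conjKernel η s * f.rep (x - s) = Real.pi⁻¹ * (k η s * (f.rep (x - s) / s)) := by
    rcases eq_or_ne s 0 with rfl | hs
    · simp [conjKernel]
    · simp only [conjKernel, k]
      field_simp
  have conjConv_eq {η : ℝ} (hη : 0 < η) :
      conjConv η f.rep x = (2 * Real.pi)⁻¹ * ∫ s, k η s * pvKernel f x s := by
    have int_weight : Integrable fun s => k η s * (f.rep (x - s) / s) := by
      have := integrable_mul_comp_sub_left (memLp_conjKernel hη) f.memLp_rep x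
      simp only [conjKernel_mul] at this
      exact (integrable_const_mul_iff (inv_ne_zero Real.pi_ne_zero).isUnit _).1 this
    rw [← integral_even_weight f x (fun s => by simp only [k, neg_sq]) int_weight, conjConv]
    simp only [conjKernel_mul, integral_const_mul]
  have k_le (η s : ℝ) : |k η s| ≤ 1 := by
    rw [abs_of_nonneg (by positivity)]
    exact div_le_one_of_le₀ (le_add_of_nonneg_right (sq_nonneg η)) (by positivity)
  have k_lim (s : ℝ) (hs : s ≠ 0) : Tendsto (fun η => k η s) (𝓝[>] 0) (𝓝 1) := by
    have k_cont : ContinuousAt (fun η => k η s) 0 := by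
      have : s ^ 2 + 0 ^ 2 ≠ 0 := by positivity
      fun_prop (disch := exact this)
    simpa [k, hs] using k_cont.tendsto.mono_left nhdsWithin_le_nhds
  exact (tendsto_integral_weight_mul_pvKernel f x (fun η => by fun_prop) k_le k_lim).congr'
    (eventually_nhdsWithin_of_forall fun η hη => (conjConv_eq hη).symm)

theorem hasHilbertTransformAt_pvIntegral : HasHilbertTransformAt f.rep x (pvIntegral f x) := by
  set k : ℝ → ℝ → ℝ := fun ε => {s : ℝ | ε < |s|}.indicator 1
  have weight_mul (ε s : ℝ) : k ε s * (f.rep (x - s) / s) =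
      {s : ℝ | ε < |s|}.indicator (fun s => s⁻¹) s * f.rep (x - s) := by
    simp only [k, indicator_apply, Pi.one_apply, ite_mul, zero_mul, one_mul, inv_mul_eq_div]
  have truncation_eq {ε : ℝ} (hε : 0 < ε) :
      (1 / Real.pi) * ∫ y in {y : ℝ | ε < |x - y|}, f.rep y / (x - y) =
        (2 * Real.pi)⁻¹ * ∫ s, k ε s * pvKernel f x s := by
    have int_weight : Integrable fun s => k ε s * (f.rep (x - s) / s) := by
      simpa only [weight_mul, Pi.mul_def] using
        (memLp_indicator_inv hε).integrable_mul (q := 2) (f.memLp_rep_sub x)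
    rw [← integral_even_weight f x (fun s => by simp [k, indicator_apply]) int_weight, one_div,
      ← integral_indicator (measurableSet_lt measurable_const (by fun_prop)),
      ← integral_sub_left_eq_self _ volume x]
    simp only [weight_mul, indicator_apply, mem_ofPred_eq, sub_sub_cancel, ite_mul, zero_mul,
      inv_mul_eq_div]
  have k_le (ε s : ℝ) : |k ε s| ≤ 1 := by
    simp only [k, indicator_apply]
    split_ifs <;> simp
  have k_lim (s : ℝ) (hs : s ≠ 0) : Tendsto (fun ε => k ε s) (𝓝[>] 0) (𝓝 1) := by
    refine tendsto_const_nhds.congr' ?_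
    filter_upwards [nhdsWithin_le_nhds (eventually_lt_nhds (abs_pos.2 hs))] with ε hε
    exact (indicator_of_mem (s := {s : ℝ | ε < |s|}) hε (1 : ℝ → ℝ)).symm
  exact (tendsto_integral_weight_mul_pvKernel f x
    (fun ε => (measurable_const (a := (1 : ℝ))).indicator (measurableSet_lt_abs ε)) k_le
    k_lim).congr'
    (eventually_nhdsWithin_of_forall fun ε hε => (truncation_eq hε).symm)

end PrincipalValue

theorem HasHilbertTransformAt.congr_ae {f g : ℝ → ℝ} {x c : ℝ}
    (hf : HasHilbertTransformAt f x c) (h : f =ᵐ[volume] g) : HasHilbertTransformAt g x c := by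
  refine hf.congr fun ε => ?_
  congr 1
  exact integral_congr_ae (ae_restrict_of_ae (h.mono fun y hy => by simp only [hy]))

section WeakLimit

variable {𝕜 ι E F : Type*} [RCLike 𝕜]

theorem exists_forall_tendsto_strongDual [NormedAddCommGroup E] [InnerProductSpace 𝕜 E]
    [CompleteSpace E] (l : Ultrafilter ι) {x : ι → E} {C : ℝ} (hx : ∀ᶠ i in l, ‖x i‖ ≤ C) :
    ∃ z : E, ∀ φ : StrongDual 𝕜 E, Tendsto (fun i => φ (x i)) l (𝓝 (φ z)) := by
  set ξ : ι → WeakDual 𝕜 E := fun i => StrongDual.toWeakDual (InnerProductSpace.toDual 𝕜 E (x i))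
  have ξ_mem : WeakDual.toStrongDual ⁻¹' Metric.closedBall (0 : StrongDual 𝕜 E) C ∈ l.map ξ :=
    hx.mono fun i hi => by
      simpa [ξ, mem_closedBall_zero_iff] using hi
  obtain ⟨ζ, -, hζ⟩ := (WeakDual.isCompact_closedBall 0 C).ultrafilter_le_nhds' _ ξ_mem
  have ξ_lim : Tendsto ξ l (𝓝 ζ) := hζ
  refine ⟨(InnerProductSpace.toDual 𝕜 E).symm (WeakDual.toStrongDual ζ), fun φ => ?_⟩
  obtain ⟨y, rfl⟩ := (InnerProductSpace.toDual 𝕜 E).surjective φ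
  have pairing_lim : Tendsto (fun i => ξ i y) l (𝓝 (ζ y)) :=
    ((WeakDual.eval_continuous y).tendsto ζ).comp ξ_lim
  convert pairing_lim.star using 2
  · simp [ξ]
  · rw [InnerProductSpace.toDual_apply_apply, ← inner_conj_symm,
      InnerProductSpace.toDual_symm_apply]
    rfl

theorem norm_le_of_forall_tendsto_strongDual [NormedAddCommGroup E] [NormedSpace 𝕜 E]
    [NormedAddCommGroup F] [NormedSpace 𝕜 F] {l : Filter ι} [l.NeBot] {x : ι → E} {z : E}
    (h : ∀ φ : StrongDual 𝕜 E, Tendsto (fun i => φ (x i)) l (𝓝 (φ z))) (T : E →L[𝕜] F) {C : ℝ}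
    (hC : ∀ᶠ i in l, ‖T (x i)‖ ≤ C) : ‖T z‖ ≤ C := by
  obtain ⟨g, g_le, g_eq⟩ := exists_dual_vector'' 𝕜 (T z)
  have bound : ‖g (T z)‖ ≤ C := by
    refine le_of_tendsto (h (g.comp T)).norm (hC.mono fun i hi => ?_)
    exact (g.le_of_opNorm_le g_le _).trans ((one_mul _).trans_le hi)
  simpa [g_eq] using bound

end WeakLimit

section HilbertTransform

theorem exists_rep_eq_pvIntegral (f : H1) :
    ∃ g : H1, ‖g.fn‖ ≤ ‖f.fn‖ ∧ ‖g.dx‖ ≤ ‖f.dx‖ ∧ g.rep = pvIntegral f := by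
  have : ∀ η : ℝ, ∃ g : H1, 0 < η → ‖g.fn‖ ≤ ‖f.fn‖ ∧ ‖g.dx‖ ≤ ‖f.dx‖ ∧
      g.rep = conjConv η f.rep := fun η => by
      by_cases hη : 0 < η
      · obtain ⟨g, hg⟩ := exists_rep_eq_conjConv hη f
        exact ⟨g, fun _ => hg⟩
      · exact ⟨0, fun h => (hη h).elim⟩
  choose g hg using this
  set l := Ultrafilter.of (𝓝[>] (0 : ℝ))
  have l_le : (l : Filter ℝ) ≤ 𝓝[>] 0 := Ultrafilter.of_le _
  have g_spec : ∀ᶠ η in l, ‖(g η).fn‖ ≤ ‖f.fn‖ ∧ ‖(g η).dx‖ ≤ ‖f.dx‖ ∧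
      (g η).rep = conjConv η f.rep :=
    l_le (eventually_nhdsWithin_of_forall fun η hη => hg η hη)
  obtain ⟨z, hz⟩ := exists_forall_tendsto_strongDual (𝕜 := ℝ) l (x := g)
    (g_spec.mono fun η h => (H1.norm_le _).trans (add_le_add h.1 h.2.1))
  refine ⟨z, norm_le_of_forall_tendsto_strongDual hz H1.fnL (g_spec.mono fun η h => h.1),
    norm_le_of_forall_tendsto_strongDual hz H1.dxL (g_spec.mono fun η h => h.2.1), ?_⟩
  ext x
  refine tendsto_nhds_unique (hz (H1.evalL x)) (((tendsto_conjConv f x).mono_left l_le).congr' ?_)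
  exact g_spec.mono fun η h => by simp only [H1.evalL_apply, h.2.2]

theorem pvIntegral_add (f g : H1) : pvIntegral (f + g) = pvIntegral f + pvIntegral g := by
  ext x
  rw [Pi.add_apply, pvIntegral, pvIntegral, pvIntegral, ← mul_add,
    ← integral_add (integrable_pvKernel f x) (integrable_pvKernel g x)]
  congr 2 with s
  simp only [pvKernel, H1.rep_add, Pi.add_apply]
  ring

theorem pvIntegral_smul (c : ℝ) (f : H1) : pvIntegral (c • f) = c • pvIntegral f := by
  ext x
  have kernel_smul (s : ℝ) : pvKernel (c • f) x s = c * pvKernel f x s := by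
    simp only [pvKernel, H1.rep_smul, Pi.smul_apply, smul_eq_mul]
    ring
  simp only [pvIntegral, Pi.smul_apply, smul_eq_mul, kernel_smul, integral_const_mul]
  ring

/-- The Hilbert transform on `H¹`. -/
noncomputable def hilbertH1 : H1 →L[ℝ] H1 :=
  LinearMap.mkContinuous
    { toFun := fun f => (exists_rep_eq_pvIntegral f).choose
      map_add' := fun f g => H1.ext_rep <| by
        rw [H1.rep_add]
        simp only [(exists_rep_eq_pvIntegral _).choose_spec.2.2]
        exact pvIntegral_add f g
      map_smul' := fun c f => H1.ext_rep <| by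
        rw [H1.rep_smul]
        simp only [(exists_rep_eq_pvIntegral _).choose_spec.2.2]
        exact pvIntegral_smul c f }
    1 fun f => by
      obtain ⟨fn_le, dx_le, -⟩ := (exists_rep_eq_pvIntegral f).choose_spec
      rw [one_mul, ← sq_le_sq₀ (norm_nonneg _) (norm_nonneg _), H1.norm_sq_eq, H1.norm_sq_eq]
      exact add_le_add (pow_le_pow_left₀ (norm_nonneg _) fn_le 2)
        (pow_le_pow_left₀ (norm_nonneg _) dx_le 2)

theorem norm_hilbertH1_le (f : H1) : ‖hilbertH1 f‖ ≤ ‖f‖ := by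
  simpa using hilbertH1.le_of_opNorm_le (LinearMap.mkContinuous_norm_le _ zero_le_one _) f

theorem norm_fn_hilbertH1_le (f : H1) : ‖(hilbertH1 f).fn‖ ≤ ‖f.fn‖ :=
  (exists_rep_eq_pvIntegral f).choose_spec.1

theorem norm_dx_hilbertH1_le (f : H1) : ‖(hilbertH1 f).dx‖ ≤ ‖f.dx‖ :=
  (exists_rep_eq_pvIntegral f).choose_spec.2.1

theorem rep_hilbertH1 (f : H1) : (hilbertH1 f).rep = pvIntegral f :=
  (exists_rep_eq_pvIntegral f).choose_spec.2.2

theorem hasHilbertTransformAt_hilbertH1 (f : H1) (x : ℝ) :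
    HasHilbertTransformAt f.rep x ((hilbertH1 f).rep x) := by
  rw [rep_hilbertH1]
  exact hasHilbertTransformAt_pvIntegral f x

end HilbertTransform

section IntegralCurve

open Metric
open scoped NNReal

variable {E : Type*} [NormedAddCommGroup E] [NormedSpace ℝ E]

theorem isIntegralCurveOn_congr {v : ℝ → E → E} {γ γ' : ℝ → E} {s : Set ℝ}
    (h : IsIntegralCurveOn γ v s) (eqOn : EqOn γ' γ s) : IsIntegralCurveOn γ' v s := fun t ht => by
  rw [eqOn ht]
  exact (h t ht).congr eqOn (eqOn ht)

theorem isIntegralCurveOn_union {v : ℝ → E → E} {γ : ℝ → E} {s t : Set ℝ} (hs : IsClosed s)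
    (ht : IsClosed t) (hγs : IsIntegralCurveOn γ v s) (hγt : IsIntegralCurveOn γ v t) :
    IsIntegralCurveOn γ v (s ∪ t) := by
  have derivWithin_of_closed {s : Set ℝ} (hs : IsClosed s) (hγ : IsIntegralCurveOn γ v s) (τ : ℝ) :
      HasDerivWithinAt γ (v τ (γ τ)) s τ := by
    by_cases hτ : τ ∈ s
    · exact hγ τ hτ
    · exact HasFDerivWithinAt.of_notMem_closure (by rwa [hs.closure_eq])
  exact fun τ _ => (derivWithin_of_closed hs hγs τ).union (derivWithin_of_closed ht hγt τ)

variable {F : E → E} (hF : ∀ R : ℝ, ∃ K : ℝ≥0, LipschitzOnWith K F (closedBall 0 R))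
include hF

theorem eqOn_of_isIntegralCurveOn_Icc {γ γ' : ℝ → E} {a b : ℝ}
    (hγ : IsIntegralCurveOn γ (fun _ => F) (Icc a b))
    (hγ' : IsIntegralCurveOn γ' (fun _ => F) (Icc a b)) (h : γ a = γ' a) :
    EqOn γ γ' (Icc a b) := by
  have hasDerivWithinAt_Ici {γ : ℝ → E} (hγ : IsIntegralCurveOn γ (fun _ => F) (Icc a b)) (t : ℝ)
      (ht : t ∈ Ico a b) : HasDerivWithinAt γ (F (γ t)) (Ici t) t :=
    (hγ t (Ico_subset_Icc_self ht)).mono_of_mem_nhdsWithin (Icc_mem_nhdsGE_of_mem ht)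
  obtain ⟨R, hR⟩ := isCompact_Icc.exists_bound_of_continuousOn hγ.continuousOn
  obtain ⟨R', hR'⟩ := isCompact_Icc.exists_bound_of_continuousOn hγ'.continuousOn
  obtain ⟨K, hK⟩ := hF (max R R')
  exact ODE_solution_unique_of_mem_Icc_right (v := fun _ => F)
    (s := fun _ => closedBall 0 (max R R')) (fun _ _ => hK) hγ.continuousOn
    (hasDerivWithinAt_Ici hγ)
    (fun t ht => mem_closedBall_zero_iff.2 (le_max_of_le_left (hR t (Ico_subset_Icc_self ht))))
    hγ'.continuousOn (hasDerivWithinAt_Ici hγ')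
    (fun t ht => mem_closedBall_zero_iff.2 (le_max_of_le_right (hR' t (Ico_subset_Icc_self ht)))) h

theorem eqOn_of_isIntegralCurveOn_Ico {γ γ' : ℝ → E} {a b : ℝ}
    (hγ : IsIntegralCurveOn γ (fun _ => F) (Ico a b))
    (hγ' : IsIntegralCurveOn γ' (fun _ => F) (Ico a b)) (h : γ a = γ' a) :
    EqOn γ γ' (Ico a b) := fun t ht => by
  have subset : Icc a t ⊆ Ico a b := Icc_subset_Ico_right ht.2
  exact eqOn_of_isIntegralCurveOn_Icc hF (hγ.mono subset) (hγ'.mono subset) h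
    (right_mem_Icc.2 ht.1)

variable [CompleteSpace E]

theorem exists_uniform_time_isIntegralCurveOn (C : ℝ) :
    ∃ ε > 0, ∀ (t₀ : ℝ) (x : E), ‖x‖ ≤ C →
      ∃ γ : ℝ → E, γ t₀ = x ∧ IsIntegralCurveOn γ (fun _ => F) (Icc t₀ (t₀ + ε)) := by
  obtain ⟨K, hK⟩ := hF (C + 1)
  set L : ℝ≥0 := ‖F 0‖₊ + K * (C + 1).toNNReal
  have F_le (y : E) (hy : y ∈ closedBall (0 : E) (C + 1)) : ‖F y‖ ≤ L := by
    have y_le : ‖y‖ ≤ C + 1 := mem_closedBall_zero_iff.1 hy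
    have radius_nonneg : 0 ≤ C + 1 := (norm_nonneg y).trans y_le
    have := hK.norm_sub_le hy (mem_closedBall_self radius_nonneg)
    rw [sub_zero] at this
    calc ‖F y‖ ≤ ‖F 0‖ + ‖F y - F 0‖ := norm_le_norm_add_norm_sub' _ _
      _ ≤ ‖F 0‖ + K * (C + 1) := by gcongr; exact this.trans (by gcongr)
      _ = L := by simp [L, radius_nonneg]
  have time_pos : (0 : ℝ) < (L + 1)⁻¹ := by positivity
  refine ⟨(L + 1)⁻¹, time_pos, fun t₀ x hx => ?_⟩
  have ball_subset : closedBall x (1 : ℝ≥0) ⊆ closedBall (0 : E) (C + 1) :=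
    closedBall_subset_closedBall' (by rw [dist_zero_right, NNReal.coe_one]; linarith)
  have picard : IsPicardLindelof (fun _ => F)
      (⟨t₀, left_mem_Icc.2 (by linarith)⟩ : Icc t₀ (t₀ + (L + 1)⁻¹)) x 1 0 L K := by
    refine .of_time_independent (fun y hy => F_le y (ball_subset hy)) (hK.mono ball_subset) ?_
    simp only [add_sub_cancel_left, sub_self, max_eq_left time_pos.le, NNReal.coe_one,
      NNReal.coe_zero, sub_zero]
    exact mul_inv_le_one_of_le₀ (le_add_of_nonneg_right zero_le_one) (by positivity)
  exact picard.exists_eq_forall_mem_Icc_hasDerivWithinAt₀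

variable {x₀ : E} {C : ℝ}
  (apriori : ∀ T ≥ 0, ∀ γ : ℝ → E, γ 0 = x₀ → IsIntegralCurveOn γ (fun _ => F) (Icc 0 T) →
    ‖γ T‖ ≤ C)
include apriori

theorem exists_isIntegralCurveOn_Icc (T : ℝ) :
    ∃ γ : ℝ → E, γ 0 = x₀ ∧ IsIntegralCurveOn γ (fun _ => F) (Icc 0 T) := by
  obtain ⟨ε, ε_pos, extend⟩ := exists_uniform_time_isIntegralCurveOn hF C
  have on_multiples (n : ℕ) :
      ∃ γ : ℝ → E, γ 0 = x₀ ∧ IsIntegralCurveOn γ (fun _ => F) (Icc 0 (n * ε)) := by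
    induction n with
    | zero =>
      refine ⟨fun _ => x₀, rfl, fun t _ => ?_⟩
      rw [Nat.cast_zero, zero_mul, Icc_self]
      exact HasFDerivWithinAt.of_subsingleton subsingleton_singleton
    | succ n ih =>
      obtain ⟨γ, γ_zero, hγ⟩ := ih
      have time_nonneg : 0 ≤ n * ε := by positivity
      obtain ⟨γ', γ'_start, hγ'⟩ := extend (n * ε) (γ (n * ε)) (apriori _ time_nonneg γ γ_zero hγ)
      refine ⟨fun t => if t ≤ n * ε then γ t else γ' t, ?_, ?_⟩
      · exact (if_pos time_nonneg).trans γ_zero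
      · rw [Nat.cast_succ, add_one_mul, ← Icc_union_Icc_eq_Icc time_nonneg (by linarith)]
        refine isIntegralCurveOn_union isClosed_Icc isClosed_Icc
          (isIntegralCurveOn_congr hγ fun t ht => if_pos ht.2)
          (isIntegralCurveOn_congr hγ' fun t ht => ?_)
        rcases ht.1.eq_or_lt with rfl | hlt
        · exact (if_pos le_rfl).trans γ'_start.symm
        · exact if_neg hlt.not_ge
  obtain ⟨n, hn⟩ := exists_nat_ge (T / ε)
  obtain ⟨γ, γ_zero, hγ⟩ := on_multiples n
  exact ⟨γ, γ_zero, hγ.mono (Icc_subset_Icc_right ((div_le_iff₀ ε_pos).1 hn))⟩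

theorem exists_isIntegralCurveOn_Ici :
    ∃ γ : ℝ → E, γ 0 = x₀ ∧ IsIntegralCurveOn γ (fun _ => F) (Ici 0) := by
  choose g g_zero hg using exists_isIntegralCurveOn_Icc hF apriori
  have agree {S T : ℝ} (hST : S ≤ T) : EqOn (g S) (g T) (Icc 0 S) :=
    eqOn_of_isIntegralCurveOn_Icc hF (hg S) ((hg T).mono (Icc_subset_Icc_right hST))
      ((g_zero S).trans (g_zero T).symm)
  refine ⟨fun t => g t t, g_zero 0, fun t ht => ?_⟩
  have lt_succ : t < t + 1 := lt_add_one t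
  have glued : IsIntegralCurveOn (fun t => g t t) (fun _ => F) (Icc 0 (t + 1)) :=
    isIntegralCurveOn_congr (hg (t + 1)) fun s hs => agree hs.2 (right_mem_Icc.2 hs.1)
  refine (glued t ⟨ht, lt_succ.le⟩).mono_of_mem_nhdsWithin ?_
  rw [← Ici_inter_Iic]
  exact inter_mem self_mem_nhdsWithin (nhdsWithin_le_nhds (Iic_mem_nhds lt_succ))

end IntegralCurve

namespace H1

section CompactSupport

variable {f : H1} {a δ : ℝ}

theorem rep_left_eq_zero (hf : ∀ x ∉ Icc a (a + δ), f.rep x = 0) : f.rep a = 0 := by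
  have eq_zero_on_Iio : EqOn f.rep (fun _ => 0) (Iio a) :=
    fun x hx => hf x fun h => not_lt.2 h.1 hx
  have eq_zero_on_closure := eq_zero_on_Iio.closure f.continuous_rep continuous_const
  rw [closure_Iio] at eq_zero_on_closure
  exact eq_zero_on_closure self_mem_Iic

theorem abs_rep_le_sqrt_mul (hf : ∀ x ∉ Icc a (a + δ), f.rep x = 0) (x : ℝ) :
    |f.rep x| ≤ √δ * ‖f.dx‖ := by
  by_cases hx : x ∈ Icc a (a + δ)
  · calc |f.rep x| = |f.rep x - f.rep a| := by rw [rep_left_eq_zero hf, sub_zero]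
      _ ≤ √(x - a) * ‖f.dx‖ := f.abs_rep_sub_le hx.1
      _ ≤ √δ * ‖f.dx‖ := by
          gcongr
          linarith [hx.2]
  · rw [hf x hx, abs_zero]
    positivity

theorem norm_fn_le_mul_norm_dx (hδ : 0 ≤ δ) (hf : ∀ x ∉ Icc a (a + δ), f.rep x = 0) :
    ‖f.fn‖ ≤ δ * ‖f.dx‖ := by
  refine le_of_sq_le_sq ?_ (by positivity)
  calc ‖f.fn‖ ^ 2 = ∫ x, f.rep x ^ 2 := by
        rw [L2.norm_sq_eq]
        exact integral_congr_ae (f.fn_ae_eq_rep.pow_const 2)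
    _ = ∫ x in Icc a (a + δ), f.rep x ^ 2 :=
        (setIntegral_eq_integral_of_forall_compl_eq_zero fun x hx => by simp [hf x hx]).symm
    _ ≤ ∫ _ in Icc a (a + δ), (√δ * ‖f.dx‖) ^ 2 := by
        refine setIntegral_mono_on f.memLp_rep.integrable_sq.integrableOn
          continuousOn_const.integrableOn_Icc measurableSet_Icc fun x _ => ?_
        rw [← sq_abs]
        gcongr
        exact abs_rep_le_sqrt_mul hf x
    _ = (δ * ‖f.dx‖) ^ 2 := by
        simp only [setIntegral_const, Real.volume_real_Icc, add_sub_cancel_left, max_eq_left hδ,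
          smul_eq_mul, mul_pow, Real.sq_sqrt hδ]
        ring

theorem dx_ae_eq_zero {K : Set ℝ} (hK : IsClosed K) (hf : ∀ x ∉ K, f.rep x = 0) :
    ∀ᵐ x, x ∉ K → f.dx x = 0 := by
  filter_upwards [f.isPrimitive_rep.ae_hasDerivAt] with x hx hxK
  have locally_zero : f.rep =ᶠ[𝓝 x] fun _ => 0 := by
    filter_upwards [hK.isOpen_compl.mem_nhds hxK] with y hy using hf y hy
  exact hx.unique ((hasDerivAt_const x (0 : ℝ)).congr_of_eventuallyEq locally_zero)

theorem rep_eq_zero_of_ae {K : Set ℝ} (hK : IsClosed K) (hf : ∀ᵐ x, x ∉ K → f.fn x = 0) :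
    ∀ x ∉ K, f.rep x = 0 := by
  have ae_eq_zero : f.rep =ᵐ[volume.restrict Kᶜ] fun _ => 0 := by
    refine (ae_restrict_iff' hK.measurableSet.compl).2 ?_
    filter_upwards [hf, f.fn_ae_eq_rep] with x hx hx_rep hxK
    rw [← hx_rep, hx hxK]
  exact Measure.eqOn_open_of_ae_eq ae_eq_zero hK.isOpen_compl f.continuous_rep.continuousOn
    continuousOn_const

theorem rep_mul_self_eq_zero {K : Set ℝ} (hf : ∀ x ∉ K, f.rep x = 0) :
    ∀ x ∉ K, (f.mul f).rep x = 0 := fun x hx => by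
  simp only [rep_mul, hf x hx, mul_zero]

theorem norm_dx_mul_self_le (hf : ∀ x ∉ Icc a (a + δ), f.rep x = 0) :
    ‖(f.mul f).dx‖ ≤ 2 * √δ * ‖f.dx‖ ^ 2 :=
  calc ‖(f.mul f).dx‖ ≤ ‖f.mulL2 f.dx‖ + ‖f.mulL2 f.dx‖ := norm_add_le _ _
    _ ≤ √δ * ‖f.dx‖ * ‖f.dx‖ + √δ * ‖f.dx‖ * ‖f.dx‖ := by
        have norm_mulL2_dx_le := norm_mulL2_le (abs_rep_le_sqrt_mul hf) f.dx
        gcongr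
    _ = 2 * √δ * ‖f.dx‖ ^ 2 := by ring

theorem norm_dx_hilbertH1_mul_self_le (hf : ∀ x ∉ Icc a (a + δ), f.rep x = 0) :
    ‖(hilbertH1 (f.mul f)).dx‖ ≤ 2 * √δ * ‖f.dx‖ ^ 2 :=
  (norm_dx_hilbertH1_le _).trans (norm_dx_mul_self_le hf)

theorem norm_fn_hilbertH1_mul_self_le (hδ : 0 ≤ δ) (hf : ∀ x ∉ Icc a (a + δ), f.rep x = 0) :
    ‖(hilbertH1 (f.mul f)).fn‖ ≤ δ * (2 * √δ) * ‖f.dx‖ ^ 2 :=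
  calc ‖(hilbertH1 (f.mul f)).fn‖ ≤ ‖(f.mul f).fn‖ := norm_fn_hilbertH1_le _
    _ ≤ δ * ‖(f.mul f).dx‖ := norm_fn_le_mul_norm_dx hδ (rep_mul_self_eq_zero hf)
    _ ≤ δ * (2 * √δ * ‖f.dx‖ ^ 2) := by
        gcongr
        exact norm_dx_mul_self_le hf
    _ = δ * (2 * √δ) * ‖f.dx‖ ^ 2 := by ring

theorem abs_rep_hilbertH1_mul_self_le (hδ : 0 ≤ δ) (hf : ∀ x ∉ Icc a (a + δ), f.rep x = 0)
    (x : ℝ) : |(hilbertH1 (f.mul f)).rep x| ≤ 4 * δ * ‖f.dx‖ ^ 2 := by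
  have norm_dx_le := norm_dx_hilbertH1_mul_self_le hf
  have norm_fn_le := norm_fn_hilbertH1_mul_self_le hδ hf
  rcases hδ.eq_or_lt with rfl | hδ_pos
  · have abs_rep_le := (hilbertH1 (f.mul f)).abs_rep_le x
    simp only [Real.sqrt_zero, mul_zero, zero_mul] at norm_dx_le norm_fn_le ⊢
    linarith
  · refine le_of_mul_le_mul_left ?_ (Real.sqrt_pos.2 hδ_pos)
    calc √δ * |(hilbertH1 (f.mul f)).rep x|
        ≤ ‖(hilbertH1 (f.mul f)).fn‖ + δ * ‖(hilbertH1 (f.mul f)).dx‖ :=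
          sqrt_mul_abs_rep_le _ hδ_pos x
      _ ≤ δ * (2 * √δ) * ‖f.dx‖ ^ 2 + δ * (2 * √δ * ‖f.dx‖ ^ 2) := by gcongr
      _ = √δ * (4 * δ * ‖f.dx‖ ^ 2) := by ring

theorem inner_dx_mul_le {u v : H1} {m : ℝ} (hu : ∀ x ∉ Icc a (a + δ), u.rep x = 0)
    (hv : ∀ᵐ x, x ∈ Icc a (a + δ) → v.rep x ≤ m) :
    inner ℝ u.dx (u.mul v).dx ≤ ‖u.dx‖ ^ 2 * (m + √δ * ‖v.dx‖) := by
  have rep_mul_dx_term_le : inner ℝ u.dx (v.mulL2 u.dx) ≤ m * ‖u.dx‖ ^ 2 := by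
    rw [L2.inner_eq, L2.norm_sq_eq, ← integral_const_mul]
    refine integral_mono_ae ((Lp.memLp _).integrable_mul (Lp.memLp _))
      ((L2.integrable_sq _).const_mul m) ?_
    filter_upwards [hv, dx_ae_eq_zero isClosed_Icc hu, v.coeFn_mulL2 u.dx] with x hvx hux h_mul
    simp only [h_mul]
    by_cases hx : x ∈ Icc a (a + δ)
    · nlinarith [mul_le_mul_of_nonneg_right (hvx hx) (sq_nonneg (u.dx x))]
    · simp [hux hx]
  have dx_mul_rep_term_le : inner ℝ u.dx (u.mulL2 v.dx) ≤ ‖u.dx‖ * (√δ * ‖u.dx‖ * ‖v.dx‖) := by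
    refine (real_inner_le_norm _ _).trans ?_
    gcongr
    exact norm_mulL2_le (abs_rep_le_sqrt_mul hu) v.dx
  calc inner ℝ u.dx (u.mul v).dx = inner ℝ u.dx (v.mulL2 u.dx) + inner ℝ u.dx (u.mulL2 v.dx) :=
        inner_add_right _ _ _
    _ ≤ m * ‖u.dx‖ ^ 2 + ‖u.dx‖ * (√δ * ‖u.dx‖ * ‖v.dx‖) :=
        add_le_add rep_mul_dx_term_le dx_mul_rep_term_le
    _ = ‖u.dx‖ ^ 2 * (m + √δ * ‖v.dx‖) := by ring

end CompactSupport

end H1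

section MemoryInequality

variable {T r : ℝ}

theorem antitoneOn_Icc_of_hasDerivWithinAt_nonpos {f f' : ℝ → ℝ}
    (hf : ∀ t ∈ Icc 0 T, HasDerivWithinAt f (f' t) (Icc 0 T) t) (hf' : ∀ t ∈ Icc 0 T, f' t ≤ 0) :
    AntitoneOn f (Icc 0 T) :=
  antitoneOn_of_hasDerivWithinAt_nonpos (convex_Icc 0 T) (fun t ht => (hf t ht).continuousWithinAt)
    (fun t ht => (hf t (interior_subset ht)).mono interior_subset)
    fun t ht => hf' t (interior_subset ht)

theorem le_mul_exp_of_deriv_le {f f' : ℝ → ℝ}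
    (hf : ∀ t ∈ Icc 0 T, HasDerivWithinAt f (f' t) (Icc 0 T) t)
    (hf' : ∀ t ∈ Icc 0 T, f' t ≤ -r * f t) : ∀ t ∈ Icc 0 T, f t ≤ f 0 * Real.exp (-r * t) := by
  intro t ht
  have deriv_exp (s : ℝ) : HasDerivAt (fun s : ℝ => Real.exp (r * s)) (Real.exp (r * s) * r) s := by
    simpa using ((hasDerivAt_id s).const_mul r).exp
  have antitone : AntitoneOn (fun s => f s * Real.exp (r * s)) (Icc 0 T) := by
    refine antitoneOn_Icc_of_hasDerivWithinAt_nonpos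
      (fun s hs => (hf s hs).mul (deriv_exp s).hasDerivWithinAt) fun s hs => ?_
    have : (f' s + r * f s) * Real.exp (r * s) ≤ 0 :=
      mul_nonpos_of_nonpos_of_nonneg (by linarith [hf' s hs]) (Real.exp_pos _).le
    linarith
  have le_initial := antitone (left_mem_Icc.2 (ht.1.trans ht.2)) ht ht.1
  simp only [mul_zero, Real.exp_zero, mul_one] at le_initial
  rwa [neg_mul, Real.exp_neg, ← div_eq_mul_inv, le_div_iff₀ (Real.exp_pos _)]

theorem le_of_bootstrap {y : ℝ → ℝ} {k k' : ℝ} (hk : k' < k) (hy : ContinuousOn y (Icc 0 T))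
    (hmono : MonotoneOn y (Icc 0 T)) (h0 : y 0 ≤ k')
    (h : ∀ t ∈ Icc 0 T, y t ≤ k → y t ≤ k') : ∀ t ∈ Icc 0 T, y t ≤ k' := by
  intro t ht
  by_contra! hlt
  have zero_mem : (0 : ℝ) ∈ Icc 0 T := left_mem_Icc.2 (ht.1.trans ht.2)
  have subset : Icc 0 t ⊆ Icc 0 T := Icc_subset_Icc_right ht.2
  obtain ⟨s, hs, hys⟩ : min k (y t) ∈ y '' Icc 0 t :=
    intermediate_value_Icc ht.1 (hy.mono subset)
      ⟨le_min (h0.trans hk.le) (hmono zero_mem ht ht.1), min_le_right _ _⟩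
  have : min k (y t) ≤ k' := hys ▸ h s (subset hs) (hys ▸ min_le_left _ _)
  exact this.not_gt (lt_min hk hlt)

variable {D D' y : ℝ → ℝ} {p q : ℝ}
  (hD : ∀ t ∈ Icc 0 T, HasDerivWithinAt D (D' t) (Icc 0 T) t)
  (hy : ∀ t ∈ Icc 0 T, HasDerivWithinAt y (D t) (Icc 0 T) t)
  (hy0 : y 0 = 0) (hD_nonneg : ∀ t ∈ Icc 0 T, 0 ≤ D t)
include hD hy hy0

theorem add_mul_integral_le_of_deriv_le (hD' : ∀ t ∈ Icc 0 T, D' t ≤ -r * D t) :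
    ∀ t ∈ Icc 0 T, D t + r * y t ≤ D 0 := by
  intro t ht
  have antitone : AntitoneOn (fun t => D t + r * y t) (Icc 0 T) :=
    antitoneOn_Icc_of_hasDerivWithinAt_nonpos (fun t ht => (hD t ht).add ((hy t ht).const_mul r))
      fun t ht => by linarith [hD' t ht]
  simpa [hy0] using antitone (left_mem_Icc.2 (ht.1.trans ht.2)) ht ht.1

include hD_nonneg

theorem mul_integral_le_of_memory_inequality (hr : 0 < r) (hq : 0 ≤ q)
    (hsmall : q * D 0 < r * (p - r)) (hineq : ∀ t ∈ Icc 0 T, D' t ≤ -(p - q * y t) * D t) :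
    ∀ t ∈ Icc 0 T, q * y t ≤ p - r := by
  have monotone : MonotoneOn (fun t => q * y t) (Icc 0 T) := by
    have antitone_neg : AntitoneOn (fun t => -y t) (Icc 0 T) :=
      antitoneOn_Icc_of_hasDerivWithinAt_nonpos (fun t ht => (hy t ht).neg)
        fun t ht => neg_nonpos.2 (hD_nonneg t ht)
    exact fun s hs t ht hst =>
      mul_le_mul_of_nonneg_left (neg_le_neg_iff.1 (antitone_neg hs ht hst)) hq
  have continuousOn : ContinuousOn (fun t => q * y t) (Icc 0 T) :=
    fun t ht => ((hy t ht).const_mul q).continuousWithinAt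
  intro t ht
  have zero_mem : (0 : ℝ) ∈ Icc 0 T := left_mem_Icc.2 (ht.1.trans ht.2)
  have threshold_lt : q * D 0 / r < p - r := by rwa [div_lt_iff₀' hr]
  refine (le_of_bootstrap threshold_lt continuousOn monotone ?_ ?_ t ht).trans threshold_lt.le
  · rw [hy0, mul_zero]
    have := hD_nonneg 0 zero_mem
    positivity
  intro t ht hyt
  have subset : Icc 0 t ⊆ Icc 0 T := Icc_subset_Icc_right ht.2
  have energy_le : D t + r * y t ≤ D 0 := by
    refine add_mul_integral_le_of_deriv_le (fun s hs => (hD s (subset hs)).mono subset)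
      (fun s hs => (hy s (subset hs)).mono subset) hy0 (fun s hs => ?_) t (right_mem_Icc.2 ht.1)
    refine (hineq s (subset hs)).trans (mul_le_mul_of_nonneg_right ?_ (hD_nonneg s (subset hs)))
    linarith [monotone (subset hs) ht hs.2]
  rw [le_div_iff₀' hr]
  nlinarith [hD_nonneg t ht]

theorem decay_of_memory_inequality (hr : 0 < r) (hq : 0 ≤ q)
    (hsmall : q * D 0 < r * (p - r)) (hineq : ∀ t ∈ Icc 0 T, D' t ≤ -(p - q * y t) * D t) :
    ∀ t ∈ Icc 0 T, r * y t ≤ D 0 ∧ D t ≤ D 0 * Real.exp (-r * t) := by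
  have deriv_le : ∀ t ∈ Icc 0 T, D' t ≤ -r * D t := fun t ht => by
    refine (hineq t ht).trans (mul_le_mul_of_nonneg_right ?_ (hD_nonneg t ht))
    linarith [mul_integral_le_of_memory_inequality hD hy hy0 hD_nonneg hr hq hsmall hineq t ht]
  refine fun t ht => ⟨?_, le_mul_exp_of_deriv_le hD deriv_le t ht⟩
  linarith [add_mul_integral_le_of_deriv_le hD hy hy0 deriv_le t ht, hD_nonneg t ht]

end MemoryInequality

/-- The right-hand side of the system `u_t = 2uv`, `v_t = H(u²)`, as a vector field on `H¹ × H¹`. -/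
noncomputable def vectorField (p : H1 × H1) : H1 × H1 :=
  ((2 : ℝ) • p.1.mul p.2, hilbertH1 (p.1.mul p.1))

section VectorField

variable {γ : ℝ → H1 × H1} {s : Set ℝ} {t : ℝ} {G : Type*} [NormedAddCommGroup G] [NormedSpace ℝ G]

theorem hasDerivWithinAt_map_fst (hγ : IsIntegralCurveOn γ (fun _ => vectorField) s) (ht : t ∈ s)
    (A : H1 →L[ℝ] G) :
    HasDerivWithinAt (fun t => A (γ t).1) ((2 : ℝ) • A ((γ t).1.mul (γ t).2)) s t := by
  rw [← map_smul]
  exact (A.comp (.fst ℝ H1 H1)).hasFDerivAt.comp_hasDerivWithinAt t (hγ t ht)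

theorem hasDerivWithinAt_map_snd (hγ : IsIntegralCurveOn γ (fun _ => vectorField) s) (ht : t ∈ s)
    (A : H1 →L[ℝ] G) :
    HasDerivWithinAt (fun t => A (γ t).2) (A (hilbertH1 ((γ t).1.mul (γ t).1))) s t :=
  (A.comp (.snd ℝ H1 H1)).hasFDerivAt.comp_hasDerivWithinAt t (hγ t ht)

/-- The integral `∫₀ᵗ ‖u_x‖²`, which measures how much `v` has changed up to time `t`. -/
noncomputable def energyIntegral (γ : ℝ → H1 × H1) (t : ℝ) : ℝ :=
  ∫ s in (0 : ℝ)..t, ‖(γ s).1.dx‖ ^ 2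

theorem energyIntegral_zero (γ : ℝ → H1 × H1) : energyIntegral γ 0 = 0 :=
  intervalIntegral.integral_same

end VectorField

section APriori

variable {γ : ℝ → H1 × H1} {T : ℝ} (hγ : IsIntegralCurveOn γ (fun _ => vectorField) (Icc 0 T))
include hγ

theorem hasDerivWithinAt_energyIntegral : ∀ t ∈ Icc 0 T,
    HasDerivWithinAt (energyIntegral γ) (‖(γ t).1.dx‖ ^ 2) (Icc 0 T) t := by
  intro t ht
  have continuousOn : ContinuousOn (fun s => ‖(γ s).1.dx‖ ^ 2) (Icc 0 T) :=
    (ContinuousOn.norm fun s hs =>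
      (hasDerivWithinAt_map_fst hγ hs H1.dxL).continuousWithinAt).pow 2
  have : Fact (t ∈ Icc 0 T) := ⟨ht⟩
  refine intervalIntegral.integral_hasDerivWithinAt_right ?_
    (continuousOn.stronglyMeasurableAtFilter_nhdsWithin measurableSet_Icc t) (continuousOn t ht)
  refine (continuousOn.mono ?_).intervalIntegrable
  rw [uIcc_of_le ht.1]
  exact Icc_subset_Icc_right ht.2

theorem norm_map_snd_sub_le {G : Type*} [NormedAddCommGroup G] [NormedSpace ℝ G] (A : H1 →L[ℝ] G)
    {c : ℝ} (hA : ∀ t ∈ Icc 0 T,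
      ‖A (hilbertH1 ((γ t).1.mul (γ t).1))‖ ≤ c * ‖(γ t).1.dx‖ ^ 2) :
    ∀ t ∈ Icc 0 T, ‖A (γ t).2 - A (γ 0).2‖ ≤ c * energyIntegral γ t := by
  have deriv_snd (t : ℝ) (ht : t ∈ Icc 0 T) :=
    (hasDerivWithinAt_map_snd hγ ht A).sub_const (A (γ 0).2)
  have deriv_bound (t : ℝ) (ht : t ∈ Icc 0 T) :=
    (hasDerivWithinAt_energyIntegral hγ t ht).const_mul c
  exact image_norm_le_of_norm_deriv_right_le_deriv_boundary'
    (fun t ht => (deriv_snd t ht).continuousWithinAt)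
    (fun t ht => (deriv_snd t (Ico_subset_Icc_self ht)).mono_of_mem_nhdsWithin
      (Icc_mem_nhdsGE_of_mem ht))
    (by simp [energyIntegral_zero])
    (fun t ht => (deriv_bound t ht).continuousWithinAt)
    (fun t ht => (deriv_bound t (Ico_subset_Icc_self ht)).mono_of_mem_nhdsWithin
      (Icc_mem_nhdsGE_of_mem ht))
    fun t ht => hA t (Ico_subset_Icc_self ht)

theorem rep_fst_eq_zero {x : ℝ} (hx : (γ 0).1.rep x = 0) : ∀ t ∈ Icc 0 T, (γ t).1.rep x = 0 := by
  obtain ⟨R, hR⟩ := isCompact_Icc.exists_bound_of_continuousOn hγ.continuousOn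
  have deriv_rep (t : ℝ) (ht : t ∈ Icc 0 T) := hasDerivWithinAt_map_fst hγ ht (H1.evalL x)
  refine eq_zero_of_abs_deriv_le_mul_abs_self_of_eq_zero_right (K := 4 * R)
    (fun t ht => (deriv_rep t ht).continuousWithinAt)
    (fun t ht => (deriv_rep t (Ico_subset_Icc_self ht)).mono_of_mem_nhdsWithin
      (Icc_mem_nhdsGE_of_mem ht)) hx fun t ht => ?_
  have abs_rep_snd_le : |(γ t).2.rep x| ≤ 2 * R :=
    ((γ t).2.abs_rep_le_norm x).trans <| mul_le_mul_of_nonneg_left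
      ((norm_snd_le _).trans (hR t (Ico_subset_Icc_self ht))) zero_le_two
  simp only [H1.evalL_apply, H1.rep_mul, smul_eq_mul, Real.norm_eq_abs, abs_mul, abs_two]
  nlinarith [mul_le_mul_of_nonneg_left abs_rep_snd_le (abs_nonneg ((γ t).1.rep x))]

variable {a δ : ℝ} (hsupp : ∀ x ∉ Icc a (a + δ), (γ 0).1.rep x = 0)
include hsupp

theorem norm_dx_snd_le : ∀ t ∈ Icc 0 T,
    ‖(γ t).2.dx‖ ≤ ‖(γ 0).2.dx‖ + 2 * √δ * energyIntegral γ t := fun t ht => by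
  have norm_sub_le := norm_map_snd_sub_le hγ H1.dxL (fun s hs =>
    H1.norm_dx_hilbertH1_mul_self_le fun x hx => rep_fst_eq_zero hγ (hsupp x hx) s hs) t ht
  exact (norm_le_norm_add_norm_sub' _ _).trans (add_le_add_right norm_sub_le _)

variable (hδ : 0 ≤ δ)
include hδ

theorem norm_fn_snd_le : ∀ t ∈ Icc 0 T,
    ‖(γ t).2.fn‖ ≤ ‖(γ 0).2.fn‖ + δ * (2 * √δ) * energyIntegral γ t := fun t ht => by
  have norm_sub_le := norm_map_snd_sub_le hγ H1.fnL (fun s hs =>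
    H1.norm_fn_hilbertH1_mul_self_le hδ fun x hx => rep_fst_eq_zero hγ (hsupp x hx) s hs) t ht
  exact (norm_le_norm_add_norm_sub' _ _).trans (add_le_add_right norm_sub_le _)

theorem rep_snd_le (x : ℝ) : ∀ t ∈ Icc 0 T,
    (γ t).2.rep x ≤ (γ 0).2.rep x + 4 * δ * energyIntegral γ t := fun t ht => by
  have norm_sub_le := norm_map_snd_sub_le hγ (H1.evalL x) (fun s hs =>
    H1.abs_rep_hilbertH1_mul_self_le hδ
      (fun x hx => rep_fst_eq_zero hγ (hsupp x hx) s hs) x) t ht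
  have := (le_abs_self _).trans norm_sub_le
  simp only [H1.evalL_apply] at this
  linarith

variable (hv₀ : ∀ᵐ x, x ∈ Icc a (a + δ) → (γ 0).2.rep x ≤ -3)
include hv₀

theorem inner_dx_fst_le : ∀ t ∈ Icc 0 T,
    2 * inner ℝ (γ t).1.dx ((2 : ℝ) • ((γ t).1.mul (γ t).2).dx) ≤
      -(12 - 4 * (√δ * ‖(γ 0).2.dx‖) - 24 * δ * energyIntegral γ t) * ‖(γ t).1.dx‖ ^ 2 := by
  intro t ht
  set y := energyIntegral γ t
  have snd_le : ∀ᵐ x, x ∈ Icc a (a + δ) → (γ t).2.rep x ≤ -3 + 4 * δ * y := by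
    filter_upwards [hv₀] with x hx hx_mem
    linarith [rep_snd_le hγ hsupp hδ x t ht, hx hx_mem]
  have sqrt_mul_dx_snd_le : √δ * ‖(γ t).2.dx‖ ≤ √δ * ‖(γ 0).2.dx‖ + 2 * δ * y :=
    calc √δ * ‖(γ t).2.dx‖ ≤ √δ * (‖(γ 0).2.dx‖ + 2 * √δ * y) := by
          gcongr
          exact norm_dx_snd_le hγ hsupp t ht
      _ = √δ * ‖(γ 0).2.dx‖ + 2 * (√δ * √δ) * y := by ring
      _ = √δ * ‖(γ 0).2.dx‖ + 2 * δ * y := by rw [Real.mul_self_sqrt hδ]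
  calc 2 * inner ℝ (γ t).1.dx ((2 : ℝ) • ((γ t).1.mul (γ t).2).dx)
      = 4 * inner ℝ (γ t).1.dx ((γ t).1.mul (γ t).2).dx := by
        rw [real_inner_smul_right]
        ring
    _ ≤ 4 * (‖(γ t).1.dx‖ ^ 2 * (-3 + 4 * δ * y + √δ * ‖(γ t).2.dx‖)) := by
        gcongr
        exact H1.inner_dx_mul_le (fun x hx => rep_fst_eq_zero hγ (hsupp x hx) t ht) snd_le
    _ ≤ 4 * (‖(γ t).1.dx‖ ^ 2 * (-3 + 4 * δ * y + (√δ * ‖(γ 0).2.dx‖ + 2 * δ * y))) := by gcongr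
    _ = -(12 - 4 * (√δ * ‖(γ 0).2.dx‖) - 24 * δ * y) * ‖(γ t).1.dx‖ ^ 2 := by ring

variable (hsmall : √δ * (‖(γ 0).2.dx‖ + 1 / 3 * √δ * ‖(γ 0).1.dx‖ ^ 2) < 1 / 4)
include hsmall

theorem energy_decay : ∀ t ∈ Icc 0 T, 8 * energyIntegral γ t ≤ ‖(γ 0).1.dx‖ ^ 2 ∧
    ‖(γ t).1.dx‖ ^ 2 ≤ ‖(γ 0).1.dx‖ ^ 2 * Real.exp (-8 * t) := by
  refine decay_of_memory_inequality (D := fun t => ‖(γ t).1.dx‖ ^ 2)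
    (p := 12 - 4 * (√δ * ‖(γ 0).2.dx‖)) (q := 24 * δ)
    (fun t ht => (hasDerivWithinAt_map_fst hγ ht H1.dxL).norm_sq)
    (hasDerivWithinAt_energyIntegral hγ) (energyIntegral_zero γ) (fun _ _ => sq_nonneg _)
    (by norm_num) (by positivity) ?_ (inner_dx_fst_le hγ hsupp hδ hv₀)
  have small : √δ * ‖(γ 0).2.dx‖ + 1 / 3 * (δ * ‖(γ 0).1.dx‖ ^ 2) < 1 / 4 := by
    convert hsmall using 1
    rw [← Real.mul_self_sqrt hδ, Real.sqrt_mul_self (Real.sqrt_nonneg δ)]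
    ring
  have : 0 ≤ √δ * ‖(γ 0).2.dx‖ := by positivity
  have : 0 ≤ δ * ‖(γ 0).1.dx‖ ^ 2 := by positivity
  linarith

theorem norm_dx_fst_le_exp : ∀ t ∈ Icc 0 T,
    ‖(γ t).1.dx‖ ≤ ‖(γ 0).1.dx‖ * Real.exp (-3 * t) := by
  intro t ht
  refine le_of_sq_le_sq ?_ (by positivity)
  calc ‖(γ t).1.dx‖ ^ 2 ≤ ‖(γ 0).1.dx‖ ^ 2 * Real.exp (-8 * t) :=
        (energy_decay hγ hsupp hδ hv₀ hsmall t ht).2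
    _ ≤ ‖(γ 0).1.dx‖ ^ 2 * Real.exp ((2 : ℕ) * (-3 * t)) := by
        refine mul_le_mul_of_nonneg_left (Real.exp_le_exp.2 ?_) (sq_nonneg _)
        push_cast
        linarith [ht.1]
    _ = (‖(γ 0).1.dx‖ * Real.exp (-3 * t)) ^ 2 := by rw [mul_pow, Real.exp_nat_mul]

theorem abs_rep_fst_le_exp (x : ℝ) : ∀ t ∈ Icc 0 T,
    |(γ t).1.rep x| ≤ √δ * (‖(γ 0).1.dx‖ * Real.exp (-3 * t)) := fun t ht =>
  (H1.abs_rep_le_sqrt_mul (fun x hx => rep_fst_eq_zero hγ (hsupp x hx) t ht) x).trans <|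
    mul_le_mul_of_nonneg_left (norm_dx_fst_le_exp hγ hsupp hδ hv₀ hsmall t ht) (Real.sqrt_nonneg δ)

theorem norm_fst_le_exp : ∀ t ∈ Icc 0 T,
    ‖(γ t).1‖ ≤ (δ + 1) * (‖(γ 0).1.dx‖ * Real.exp (-3 * t)) := fun t ht =>
  calc ‖(γ t).1‖ ≤ ‖(γ t).1.fn‖ + ‖(γ t).1.dx‖ := (γ t).1.norm_le
    _ ≤ δ * ‖(γ t).1.dx‖ + ‖(γ t).1.dx‖ := by
        gcongr
        exact H1.norm_fn_le_mul_norm_dx hδ fun x hx => rep_fst_eq_zero hγ (hsupp x hx) t ht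
    _ = (δ + 1) * ‖(γ t).1.dx‖ := by ring
    _ ≤ (δ + 1) * (‖(γ 0).1.dx‖ * Real.exp (-3 * t)) := by
        gcongr
        exact norm_dx_fst_le_exp hγ hsupp hδ hv₀ hsmall t ht

theorem norm_snd_le_add : ∀ t ∈ Icc 0 T,
    ‖(γ t).2‖ ≤ ‖(γ 0).2.fn‖ + ‖(γ 0).2.dx‖ + (δ * √δ + √δ) * ‖(γ 0).1.dx‖ ^ 2 := by
  intro t ht
  have energy_le : 2 * energyIntegral γ t ≤ ‖(γ 0).1.dx‖ ^ 2 := by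
    linarith [(energy_decay hγ hsupp hδ hv₀ hsmall t ht).1, sq_nonneg ‖(γ 0).1.dx‖]
  calc ‖(γ t).2‖ ≤ ‖(γ t).2.fn‖ + ‖(γ t).2.dx‖ := (γ t).2.norm_le
    _ ≤ (‖(γ 0).2.fn‖ + δ * (2 * √δ) * energyIntegral γ t) +
          (‖(γ 0).2.dx‖ + 2 * √δ * energyIntegral γ t) :=
        add_le_add (norm_fn_snd_le hγ hsupp hδ t ht) (norm_dx_snd_le hγ hsupp t ht)
    _ = ‖(γ 0).2.fn‖ + ‖(γ 0).2.dx‖ + (δ * √δ + √δ) * (2 * energyIntegral γ t) := by ring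
    _ ≤ ‖(γ 0).2.fn‖ + ‖(γ 0).2.dx‖ + (δ * √δ + √δ) * ‖(γ 0).1.dx‖ ^ 2 := by gcongr

end APriori

theorem H1.norm_mul_sub_mul_le {f g f' g' : H1} {R d : ℝ} (hg : ‖g‖ ≤ R) (hf' : ‖f'‖ ≤ R)
    (hf : ‖f - f'‖ ≤ d) (hg' : ‖g - g'‖ ≤ d) : ‖f.mul g - f'.mul g'‖ ≤ 12 * R * d := by
  have hd : 0 ≤ d := (norm_nonneg _).trans hf
  have hR : 0 ≤ R := (norm_nonneg _).trans hg
  calc ‖f.mul g - f'.mul g'‖ = ‖(f - f').mul g + f'.mul (g - g')‖ := by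
        simp only [← H1.mulL_apply, map_sub, sub_apply, sub_add_sub_cancel]
    _ ≤ 6 * ‖f - f'‖ * ‖g‖ + 6 * ‖f'‖ * ‖g - g'‖ :=
        (norm_add_le _ _).trans (add_le_add (H1.norm_mul_le _ _) (H1.norm_mul_le _ _))
    _ ≤ 6 * d * R + 6 * R * d := by gcongr
    _ = 12 * R * d := by ring

theorem exists_lipschitzOnWith_vectorField (R : ℝ) :
    ∃ K : NNReal, LipschitzOnWith K vectorField (Metric.closedBall 0 R) := by
  refine ⟨(24 * R).toNNReal, LipschitzOnWith.of_dist_le_mul fun p hp q hq => ?_⟩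
  rw [mem_closedBall_zero_iff] at hp hq
  have hR : 0 ≤ R := (norm_nonneg _).trans hp
  have norm_fst_sub_le : ‖p.1 - q.1‖ ≤ ‖p - q‖ := norm_fst_le (p - q)
  have norm_snd_sub_le : ‖p.2 - q.2‖ ≤ ‖p - q‖ := norm_snd_le (p - q)
  rw [dist_eq_norm, dist_eq_norm, Real.coe_toNNReal _ (by positivity)]
  refine max_le ?_ ?_
  · calc ‖(2 : ℝ) • p.1.mul p.2 - (2 : ℝ) • q.1.mul q.2‖ = 2 * ‖p.1.mul p.2 - q.1.mul q.2‖ := by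
          rw [← smul_sub, norm_smul, Real.norm_of_nonneg zero_le_two]
      _ ≤ 2 * (12 * R * ‖p - q‖) := by
          gcongr
          exact H1.norm_mul_sub_mul_le ((norm_snd_le p).trans hp) ((norm_fst_le q).trans hq)
            norm_fst_sub_le norm_snd_sub_le
      _ = 24 * R * ‖p - q‖ := by ring
  · calc ‖hilbertH1 (p.1.mul p.1) - hilbertH1 (q.1.mul q.1)‖ ≤ ‖p.1.mul p.1 - q.1.mul q.1‖ := by
          rw [← map_sub]
          exact norm_hilbertH1_le _
      _ ≤ 12 * R * ‖p - q‖ := H1.norm_mul_sub_mul_le ((norm_fst_le p).trans hp)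
          ((norm_fst_le q).trans hq) norm_fst_sub_le norm_fst_sub_le
      _ ≤ 24 * R * ‖p - q‖ := by gcongr; norm_num

theorem continuous_vectorField : Continuous vectorField :=
  ((H1.mulL.continuous.comp continuous_fst).clm_apply continuous_snd).const_smul (2 : ℝ) |>.prodMk
    (hilbertH1.continuous.comp
      ((H1.mulL.continuous.comp continuous_fst).clm_apply continuous_fst))

theorem H1.fn_two_smul_mul (f g : H1) :
    ((2 : ℝ) • f.mul g).fn =ᵐ[volume] fun x => 2 * f.fn x * g.fn x := by
  filter_upwards [Lp.coeFn_smul (2 : ℝ) (f.mul g).fn, f.coeFn_mulL2 g.fn, f.fn_ae_eq_rep]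
    with x h_smul h_mul h_rep
  calc ((2 : ℝ) • f.mul g).fn x = 2 * f.mulL2 g.fn x := h_smul
    _ = 2 * f.fn x * g.fn x := by rw [h_mul, h_rep, mul_assoc]

theorem hasHilbertTransformAt_sq (f : H1) :
    ∀ᵐ x, HasHilbertTransformAt (fun y => f.fn y ^ 2) x ((hilbertH1 (f.mul f)).fn x) := by
  have sq_ae_eq : (fun y => f.fn y ^ 2) =ᵐ[volume] (f.mul f).rep := by
    filter_upwards [f.fn_ae_eq_rep] with y hy
    rw [hy, H1.rep_mul, sq]
  filter_upwards [(hilbertH1 (f.mul f)).fn_ae_eq_rep] with x hx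
  rw [hx]
  exact (hasHilbertTransformAt_hilbertH1 (f.mul f) x).congr_ae sq_ae_eq.symm

theorem contDiffOn_one_of_hasDerivWithinAt {E : Type*} [NormedAddCommGroup E] [NormedSpace ℝ E]
    {f f' : ℝ → E} {s : Set ℝ} (hs : UniqueDiffOn ℝ s)
    (hf : ∀ t ∈ s, HasDerivWithinAt f (f' t) s t) (hf' : ContinuousOn f' s) :
    ContDiffOn ℝ 1 f s :=
  (contDiffOn_one_iff_derivWithin hs).2 ⟨fun t ht => (hf t ht).differentiableWithinAt,
    hf'.congr fun t ht => (hf t ht).derivWithin (hs t ht)⟩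

theorem isSolutionOn_of_isIntegralCurveOn {I : Set ℝ} (hI : UniqueDiffOn ℝ I) {u₀ v₀ : H1}
    {γ : ℝ → H1 × H1} (γ_zero : γ 0 = (u₀, v₀))
    (hγ : IsIntegralCurveOn γ (fun _ => vectorField) I) :
    IsSolutionOn I u₀ v₀ (fun t => (γ t).1) fun t => (γ t).2 := by
  have deriv_fst (t : ℝ) (ht : t ∈ I) :
      HasDerivWithinAt (fun t => (γ t).1) (vectorField (γ t)).1 I t :=
    hasDerivWithinAt_map_fst hγ ht (.id ℝ H1)
  have deriv_snd (t : ℝ) (ht : t ∈ I) :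
      HasDerivWithinAt (fun t => (γ t).2) (vectorField (γ t)).2 I t :=
    hasDerivWithinAt_map_snd hγ ht (.id ℝ H1)
  have continuousOn : ContinuousOn (fun t => vectorField (γ t)) I :=
    continuous_vectorField.comp_continuousOn hγ.continuousOn
  refine ⟨by rw [γ_zero], by rw [γ_zero],
    contDiffOn_one_of_hasDerivWithinAt hI deriv_fst continuousOn.fst,
    contDiffOn_one_of_hasDerivWithinAt hI deriv_snd continuousOn.snd,
    fun t ht => ?_, fun t ht => ?_⟩
  · rw [(deriv_fst t ht).derivWithin (hI t ht)]
    exact (γ t).1.fn_two_smul_mul (γ t).2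
  · rw [(deriv_snd t ht).derivWithin (hI t ht)]
    exact hasHilbertTransformAt_sq (γ t).1

theorem IsSolutionOn.isIntegralCurveOn {I : Set ℝ} {u₀ v₀ : H1} {u v : ℝ → H1}
    (h : IsSolutionOn I u₀ v₀ u v) :
    IsIntegralCurveOn (fun t => (u t, v t)) (fun _ => vectorField) I := by
  intro t ht
  have derivWithin_u : derivWithin u I t = (2 : ℝ) • (u t).mul (v t) :=
    H1.ext_fn (by
    filter_upwards [h.eqn_u t ht, (u t).fn_two_smul_mul (v t)] with x hx hx'
    exact hx.trans hx'.symm)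
  have derivWithin_v : derivWithin v I t = hilbertH1 ((u t).mul (u t)) := H1.ext_fn (by
    filter_upwards [h.eqn_v t ht, hasHilbertTransformAt_sq (u t)] with x hx hx'
    exact tendsto_nhds_unique hx hx')
  have deriv_u := (h.contDiffOn_u.differentiableOn one_ne_zero t ht).hasDerivWithinAt
  have deriv_v := (h.contDiffOn_v.differentiableOn one_ne_zero t ht).hasDerivWithinAt
  rw [derivWithin_u] at deriv_u
  rw [derivWithin_v] at deriv_v
  exact deriv_u.prodMk deriv_v

theorem H1.eLpNorm_top_fn_le {f : H1} {C : ℝ} (hC : ∀ x, |f.rep x| ≤ C) :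
    eLpNorm f.fn ∞ volume ≤ ENNReal.ofReal C := by
  rw [eLpNorm_exponent_top]
  refine eLpNormEssSup_le_of_ae_bound ?_
  filter_upwards [f.fn_ae_eq_rep] with x hx
  rw [hx]
  exact hC x

section Global

variable {u₀ v₀ : H1} {a δ : ℝ} (hδ : 0 ≤ δ)
  (hsupp : ∀ᵐ x, x ∉ Icc a (a + δ) → u₀.fn x = 0)
  (hv₀ : ∀ᵐ x, x ∈ Icc a (a + δ) → v₀.fn x ≤ -3)
  (hsmall : √δ * (‖v₀.dx‖ + 1 / 3 * √δ * ‖u₀.dx‖ ^ 2) < 1 / 4)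
include hδ hsupp hv₀ hsmall

theorem exists_uniform_decay : ∃ C : ℝ, ∀ T ≥ 0, ∀ γ : ℝ → H1 × H1, γ 0 = (u₀, v₀) →
    IsIntegralCurveOn γ (fun _ => vectorField) (Icc 0 T) →
      eLpNorm (γ T).1.fn ∞ volume ≤ ENNReal.ofReal (C * Real.exp (-3 * T)) ∧
      ‖(γ T).1‖ ≤ C * Real.exp (-3 * T) ∧ ‖(γ T).2‖ ≤ C := by
  have rep_supp : ∀ x ∉ Icc a (a + δ), u₀.rep x = 0 := H1.rep_eq_zero_of_ae isClosed_Icc hsupp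
  have rep_le : ∀ᵐ x, x ∈ Icc a (a + δ) → v₀.rep x ≤ -3 := by
    filter_upwards [hv₀, v₀.fn_ae_eq_rep] with x hx hx_rep
    rwa [← hx_rep]
  set A := √δ * ‖u₀.dx‖ with hA
  set A' := (δ + 1) * ‖u₀.dx‖ with hA'
  set B := ‖v₀.fn‖ + ‖v₀.dx‖ + (δ * √δ + √δ) * ‖u₀.dx‖ ^ 2
  have A_nonneg : 0 ≤ A := by positivity
  have A'_nonneg : 0 ≤ A' := by positivity
  have B_nonneg : 0 ≤ B := by positivity
  refine ⟨A + A' + B, fun T hT γ γ_zero hγ => ⟨H1.eLpNorm_top_fn_le fun x => ?_, ?_, ?_⟩⟩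
  · have := abs_rep_fst_le_exp hγ (by rwa [γ_zero]) hδ (by rwa [γ_zero]) (by rwa [γ_zero]) x T
      (right_mem_Icc.2 hT)
    rw [γ_zero, ← mul_assoc, ← hA] at this
    exact this.trans (by gcongr; linarith)
  · have := norm_fst_le_exp hγ (by rwa [γ_zero]) hδ (by rwa [γ_zero]) (by rwa [γ_zero]) T
      (right_mem_Icc.2 hT)
    rw [γ_zero, ← mul_assoc, ← hA'] at this
    exact this.trans (by gcongr; linarith)
  · have := norm_snd_le_add hγ (by rwa [γ_zero]) hδ (by rwa [γ_zero]) (by rwa [γ_zero]) T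
      (right_mem_Icc.2 hT)
    rw [γ_zero] at this
    exact this.trans (by linarith)

theorem exists_isIntegralCurveOn_Ici_decay : ∃ (γ : ℝ → H1 × H1) (C : ℝ), γ 0 = (u₀, v₀) ∧
    IsIntegralCurveOn γ (fun _ => vectorField) (Ici 0) ∧ 0 ≤ C ∧ ∀ t ≥ 0,
      eLpNorm (γ t).1.fn ∞ volume ≤ ENNReal.ofReal (C * Real.exp (-3 * t)) ∧
      ‖(γ t).1‖ ≤ C * Real.exp (-3 * t) ∧ ‖(γ t).2‖ ≤ C := by
  obtain ⟨C, decay⟩ := exists_uniform_decay hδ hsupp hv₀ hsmall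
  obtain ⟨γ, γ_zero, hγ⟩ := exists_isIntegralCurveOn_Ici exists_lipschitzOnWith_vectorField
    (x₀ := (u₀, v₀)) (C := C) fun T hT γ γ_zero hγ => by
      obtain ⟨-, fst_le, snd_le⟩ := decay T hT γ γ_zero hγ
      have C_nonneg : 0 ≤ C := (norm_nonneg _).trans snd_le
      exact max_le (fst_le.trans (mul_le_of_le_one_right C_nonneg
        (Real.exp_le_one_iff.2 (by linarith)))) snd_le
  have decay_on_Ici (t : ℝ) (ht : t ≥ 0) := decay t ht γ γ_zero (hγ.mono Icc_subset_Ici_self)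
  exact ⟨γ, C, γ_zero, hγ, (norm_nonneg _).trans (decay_on_Ici 0 le_rfl).2.2, decay_on_Ici⟩

end Global

end NonlocalSystem

theorem mainTheorem2 (u₀ v₀ : NonlocalSystem.H1) (a δ : ℝ) (hδ : 0 ≤ δ)
    (hsupp : ∀ᵐ x, x ∉ Icc a (a + δ) → u₀.fn x = 0)
    (hv₀ : ∀ᵐ x, x ∈ Icc a (a + δ) → v₀.fn x ≤ -3)
    (hsmall : √δ * (‖v₀.dx‖ + 1 / 3 * √δ * ‖u₀.dx‖ ^ 2) < 1 / 4) :
    ∃ u v : ℝ → NonlocalSystem.H1,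
      NonlocalSystem.IsSolutionOn (Ici 0) u₀ v₀ u v ∧
      (∀ T > 0, ∀ u' v' : ℝ → NonlocalSystem.H1,
        NonlocalSystem.IsSolutionOn (Ico 0 T) u₀ v₀ u' v' →
          ∀ t ∈ Ico 0 T, u' t = u t ∧ v' t = v t) ∧
      (∃ M : ℝ, ∀ t ≥ 0, ‖u t‖ ≤ M ∧ ‖v t‖ ≤ M) ∧
      ∃ C : ℝ, ∀ t ≥ 0,
        eLpNorm (u t).fn ∞ volume ≤ ENNReal.ofReal (C * Real.exp (-3 * t)) ∧
        ‖u t‖ ≤ C * Real.exp (-3 * t) ∧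
        ‖v t‖ ≤ C := by
  open NonlocalSystem in
  obtain ⟨γ, C, γ_zero, hγ, C_nonneg, decay⟩ :=
    exists_isIntegralCurveOn_Ici_decay hδ hsupp hv₀ hsmall
  refine ⟨fun t => (γ t).1, fun t => (γ t).2,
    isSolutionOn_of_isIntegralCurveOn (uniqueDiffOn_Ici 0) γ_zero hγ, ?_, ⟨C, fun t ht => ?_⟩,
    C, decay⟩
  · intro T _ u' v' hsol t ht
    have initial_eq : (u' 0, v' 0) = γ 0 := by rw [γ_zero, hsol.initial_u, hsol.initial_v]
    exact Prod.ext_iff.1 <| eqOn_of_isIntegralCurveOn_Ico exists_lipschitzOnWith_vectorField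
      hsol.isIntegralCurveOn (hγ.mono Ico_subset_Ici_self) initial_eq ht
  · obtain ⟨-, fst_le, snd_le⟩ := decay t ht
    have exp_le_one : Real.exp (-3 * t) ≤ 1 := Real.exp_le_one_iff.2 (by linarith)
    exact ⟨fst_le.trans (mul_le_of_le_one_right C_nonneg exp_le_one), snd_le⟩
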